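/- Let $K$ be a field of characteristic $0$, $A$ an associative unital $K$-algebra, $m\ge 0$, and let $\Lambda$ be a set of positive integers with $1\in\Lambda$. Let $R_1=\mathcal H, R_2,R_3,\dots\in A$ with $R_n=0$ for $n\notin\Lambda$, and suppose that the $R_i$ with $i\in\Lambda$, $i\le m$, are free, i.e. the products $R_{i_1}R_{i_2}\cdots R_{i_k}$ ($k\ge0$) of them are linearly independent over $K$. Let $p_1,\dots,p_r\in K$ with $p_1+\dots+p_r=1$, and let $R_{jn}=c_{jn}R_n$ with $c_{jn}\in K$, $c_{j1}=1$ (for instance $c_{jn}=1$, all factors below being equal to one $Q$; or $c_{jn}=(-1)^{(j-1)(n-1)}$). Consider the formal power series in $x$ $$Q^{(j)}(x)=\exp(x\mathcal H+x^2R_{j2}+x^3R_{j3}+\cdots),\qquad F(x)=Q^{(1)}(p_1x)\,Q^{(2)}(p_2x)\cdots Q^{(r)}(p_rx);$$ $F$ is called an $m$-th order approximant of $\exp(x\mathcal H)$ if $F(x)=\exp(x\mathcal H)+O(x^{m+1})$. Let $Y_n=\sum_{j}p_j^nR_{jn}$. Let $\mathrm{PS}$ be the linear operation on noncommutative polynomials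 in formal letters $R_{jn}$ that orders the letters of each word by increasing $j$ and replaces each block of letters with the same $j$ by the average of all its rearrangements; afterwards $R_{jn}=c_{jn}R_n$ is substituted, the $R_n$ being treated as noncommuting letters. For $n=\{n_j\}$ (finitely many non-zero $n_j\in\mathbb N$) put $|n|=n_1+2n_2+3n_3+\cdots$, and for a word $(i_1,i_2,\dots)$ in which each $j$ occurs $n_j$ times (content $n$) let $g(i_1,i_2,\dots)$ be the coefficient of $R_{i_1}R_{i_2}\cdots$ in $T_n:=\frac{1}{n_1!n_2!\cdots}\mathrm{PS}(Y_1^{n_1}Y_2^{n_2}\cdots)$. Let $X_m$ be the set of all $n$ with $n_j=0$ for $j\notin\Lambda$ and $|n|\le m$, excluding those with $n_2=n_3=\cdots=0$. A Lyndon word is a non-empty word that is not a proper power and is lexicographically minimal among its cyclic permutations (with $R_1<R_2<\cdots$). Then: (a) $F$ is an $m$-th order approximant of $\exp(x\mathcal H)$ if and only if $g(i_1,i_2,\dots)=0$ for every Lyndon word $(i_1,i_2,\dots)$ whose content lies in $X_m$. (b) If all elements of $\Lambda$ are odd and $p_{r+1-j}=p_j$, $c_{r+1-j,n}=c_{jn}$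 for all $j,n$ (symmetric decompositions), then (a) also holds with $X_m$ replaced by $\{n\in X_m : |n| \text{ odd}\}$. (c) The Lyndon-word coefficients form a minimal independent set of determining equations in the following sense. For every $n\in X_m$: if $F$ is an approximant of order $|n|-1$, then $T_n$ is a Lie element of content $n$, that is, it lies in the Lie algebra generated by the letters $R_i$ inside the free associative algebra and involves only words of content $n$; and for arbitrarily prescribed values $\beta(w)\in K$ there is exactly one Lie element of content $n$ whose coefficient at $w$ is $\beta(w)$ for every Lyndon word $w$ of content $n$. -/

import Mathlib

open scoped PowerSeries

noncomputable section

namespace HigherOrderDecomposition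

/-! ### Formal power series in `x` over an algebra of operators -/

section Series

variable {K A : Type*} [Field K] [Ring A] [Algebra K A]

/-- The exponential `∑ f ^ k / k!` of a formal power series `f` with zero constant term and
coefficients in a noncommutative algebra. The coefficient of `x ^ n` only involves
the powers `f ^ k` with `k ≤ n`. -/
def expSeries (K : Type*) {A : Type*} [Field K] [Ring A] [Algebra K A] (f : A⟦X⟧) : A⟦X⟧ :=
  PowerSeries.mk fun n =>
    ∑ k ∈ Finset.range (n + 1), ((k.factorial : K)⁻¹) • PowerSeries.coeff n (f ^ k)

/-- `f (a x)`. -/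
def rescale (a : K) (f : A⟦X⟧) : A⟦X⟧ :=
  PowerSeries.mk fun n => (a ^ n) • PowerSeries.coeff n f

/-- `Q (x) = exp (x S₁ + x ^ 2 S₂ + x ^ 3 S₃ + ⋯)`. -/
def factor (K : Type*) {A : Type*} [Field K] [Ring A] [Algebra K A] (S : ℕ → A) : A⟦X⟧ :=
  expSeries K (PowerSeries.mk fun n => if n = 0 then 0 else S n)

/-- `F (x) = Q⁽¹⁾ (p₁ x) Q⁽²⁾ (p₂ x) ⋯ Q⁽ʳ⁾ (pᵣ x)`, where
`Q⁽ʲ⁾ (x) = exp (x R_{j1} + x ^ 2 R_{j2} + ⋯)` and `R_{jn} = c_{jn} R_n`. -/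
def productFormula {r : ℕ} (p : Fin r → K) (c : Fin r → ℕ → K) (R : ℕ → A) : A⟦X⟧ :=
  (List.ofFn fun j => rescale (p j) (factor K fun n => c j n • R n)).prod

/-- `F (x) = exp (x H) + O (x ^ (m + 1))`. -/
def IsApproximant (K : Type*) {A : Type*} [Field K] [Ring A] [Algebra K A]
    (m : ℕ) (H : A) (F : A⟦X⟧) : Prop :=
  ∀ k ≤ m, PowerSeries.coeff k F
    = PowerSeries.coeff k (expSeries K (PowerSeries.monomial 1 H))

/-- The operators `R i`, `i ∈ Λ`, are free: the products `R i₁ R i₂ ⋯ R iₖ` with all indices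
in `Λ` are linearly independent. -/
def IsFreeFamily (K : Type*) {A : Type*} [Field K] [Ring A] [Algebra K A]
    (Λ : Set ℕ) (R : ℕ → A) : Prop :=
  LinearIndependent K fun w : {w : List ℕ // ∀ i ∈ w, i ∈ Λ} => (w.1.map R).prod

end Series

/-! ### Words and Lyndon words -/

/-- A word is primitive if it is not a proper power of another word. -/
def IsPrimitiveWord (w : List ℕ) : Prop :=
  ∀ (u : List ℕ) (k : ℕ), w = (List.replicate k u).flatten → u = w

/-- Lyndon words: nonempty primitive words that are lexicographically minimal in
their conjugacy class. -/
def IsLyndon (w : List ℕ) : Prop :=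
  w ≠ [] ∧ IsPrimitiveWord w ∧ ∀ a b : List ℕ, w = a ++ b → w ≤ b ++ a

/-- `w` is a permutation of the word in which each letter `i` occurs `n i` times. -/
def HasContent (w : List ℕ) (n : ℕ →₀ ℕ) : Prop :=
  ∀ i, w.count i = n i

/-! ### Time-ordered symmetrized products -/

section TimeOrdering

variable {K : Type*} [Field K]

/-- The free associative algebra on a set of letters, with the words as a basis. -/
abbrev WordAlgebra (K : Type*) [Field K] (T : Type*) : Type _ := MonoidAlgebra K (FreeMonoid T)

/-- The element of the free algebra given by a word. -/
def word (K : Type*) [Field K] {T : Type*} (w : List T) : WordAlgebra K T :=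
  MonoidAlgebra.single (FreeMonoid.ofList w) 1

/-- The coefficient of a word. -/
def wordCoeff {T : Type*} (P : WordAlgebra K T) (w : List T) : K :=
  P.coeff (FreeMonoid.ofList w)

/-- Symmetrization of a word of length `t`: the average of its `t!` rearrangements. (Equal
letters give equal rearrangements, which produces the factor `p! q! ⋯ / (p + q + ⋯)!` in front of
the sum over distinct permutations.) -/
def symmetrize (K : Type*) [Field K] {T : Type*} (w : List T) : WordAlgebra K T :=
  ((w.length.factorial : K)⁻¹) • (w.permutations.map (word K)).sum

/-- The effect of P and S on a word in the letters `R_{jn}` (encoded as `(j, n)`): the letters are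
time-ordered with respect to `j`, and those with the same `j` are symmetrized. -/
def timeOrderWord (K : Type*) [Field K] {r : ℕ} (w : List (Fin r × ℕ)) :
    WordAlgebra K (Fin r × ℕ) :=
  (List.ofFn fun j : Fin r => symmetrize K (w.filter fun l => l.1 = j)).prod

/-- The linear operation PS on the free algebra in the letters `R_{jn}`. -/
def PS (K : Type*) [Field K] {r : ℕ} (P : WordAlgebra K (Fin r × ℕ)) :
    WordAlgebra K (Fin r × ℕ) :=
  P.coeff.sum fun w a => a • timeOrderWord K (FreeMonoid.toList w)

/-- `Y_n = ∑ j, p_j ^ n R_{jn}`. -/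
def Y {r : ℕ} (p : Fin r → K) (n : ℕ) : WordAlgebra K (Fin r × ℕ) :=
  ∑ j, (p j ^ n) • word K [(j, n)]

/-- `Y₁ ^ n₁ Y₂ ^ n₂ ⋯`. -/
def YMonomial {r : ℕ} (p : Fin r → K) (n : ℕ →₀ ℕ) : WordAlgebra K (Fin r × ℕ) :=
  ((n.support.sort (· ≤ ·)).map fun i => Y p i ^ n i).prod

/-- The substitution `R_{jn} = c_{jn} R_n`. -/
def substitute {r : ℕ} (c : Fin r → ℕ → K) : WordAlgebra K (Fin r × ℕ) →ₐ[K] WordAlgebra K ℕ :=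
  MonoidAlgebra.lift K (WordAlgebra K ℕ) (FreeMonoid (Fin r × ℕ))
    (FreeMonoid.lift fun l => c l.1 l.2 • word K [l.2])

/-- `PS (Y₁ ^ n₁ Y₂ ^ n₂ ⋯) / (n₁! n₂! ⋯)`, as a noncommutative polynomial in the `R_n`. -/
def PSTerm {r : ℕ} (p : Fin r → K) (c : Fin r → ℕ → K) (n : ℕ →₀ ℕ) : WordAlgebra K ℕ :=
  ((n.prod fun _ k => (k.factorial : K))⁻¹) • substitute c (PS K (YMonomial p n))

end TimeOrdering

/-! ### The index sets `X_m` -/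

/-- `n₁ + 2 n₂ + 3 n₃ + ⋯`. -/
def weight (n : ℕ →₀ ℕ) : ℕ := n.sum fun i k => i * k

/-- `X_m`: the `{n_j}` with `n_j = 0` for `j ∉ Λ` and `n₁ + 2 n₂ + ⋯ ≤ m`, excluding those
with `n₂ = n₃ = ⋯ = 0`. -/
def indexSet (Λ : Set ℕ) (m : ℕ) : Set (ℕ →₀ ℕ) :=
  {n | (∀ i, n i ≠ 0 → i ∈ Λ) ∧ weight n ≤ m ∧ ∃ i, i ≠ 1 ∧ n i ≠ 0}

/-- `X_m` for symmetric decompositions: only the odd values of `n₁ + 3 n₃ + 5 n₅ + ⋯` occur. -/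
def oddIndexSet (Λ : Set ℕ) (m : ℕ) : Set (ℕ →₀ ℕ) :=
  {n | n ∈ indexSet Λ m ∧ Odd (weight n)}

/-! ### Lie elements -/

section Lie

attribute [local instance] LieRing.ofAssociativeRing

/-- The Lie elements with content `n`: the elements of the free Lie algebra on the letters `R_i`
(the Lie subalgebra of the free algebra generated by the letters) in which each letter `R_i`
occurs `n i` times. -/
def lieElements (K : Type*) [Field K] (n : ℕ →₀ ℕ) : Set (WordAlgebra K ℕ) :=
  {P | P ∈ LieSubalgebra.lieSpan K (WordAlgebra K ℕ) (Set.range fun i : ℕ => word K [i]) ∧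
    ∀ w : List ℕ, wordCoeff P w ≠ 0 → HasContent w n}

end Lie

end HigherOrderDecomposition

end

/-!
The product formula is a substitution instance of a noncommutative power series in the letters
`R_n`, the product of the exponentials of `∑ i, p_j ^ i c_{ji} R_i`. Its coefficients, as a function
`G` of words, are a convolution of the coefficient functions of exponentials (`productCoeff`), and
they are also the coefficients of the time-ordered symmetrized products (`wordCoeff_PSTerm`). By
freeness, the approximation property of order `k` says that `G` vanishes at all words of weight at
most `k` that contain a letter other than `R_1` (`isApproximant_iff`).

The function `G` is a character of the shuffle algebra: `G u * G v` is the sum of `G` over all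
shuffles of `u` and `v` (`isShuffleCharacter_productCoeff`). If `G` vanishes at the words just
described up to weight `N - 1`, it therefore vanishes on proper shuffles of weight `N`. A functional
that vanishes on the proper shuffles of some content is determined by its values at the Lyndon words
(`eq_zero_of_lyndon`), because every other word can be cut into two words of which it is the largest
shuffle. This proves (a) by induction on the weight. For symmetric decompositions `G` is invariant
under reversal of words, while a functional that vanishes on proper shuffles acquires the sign
`(-1) ^ (length - 1)` by the antipode identity; so `G` vanishes automatically at the words of even
weight (`IsShuffleCharacter.eq_zero_of_even`), which proves (b).

For (c), Lie elements vanish on proper shuffles, and every Lyndon word is the smallest word of some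
Lie element, its standard bracketing (`exists_lyndon_bracket`). By triangularity there are Lie
elements with prescribed coefficients at the Lyndon words, and they are unique by the above. The
converse half of Ree's theorem follows: a polynomial that vanishes on proper shuffles equals the Lie
element with the same coefficients at the Lyndon words (`mem_lieElements_of_shuffleSum`).

All comparisons of words are made numerically. A word is read as a numeral in a base `B` that
exceeds all its letters, and `slope` is the number `0.www…` whose base `B` digits repeat the word
`w`. Comparing `x ++ y` with `y ++ x` is comparing the slopes of `x` and `y`, and the excess over a
given slope is additive under concatenation up to powers of `B`, which makes the extremal properties
of Lyndon words short computations.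
-/

noncomputable section

namespace HigherOrderDecomposition

/-! ### Comparing words through their values in a positional number system -/

/-- The value of a word read as a numeral in base `B`. On words of equal length with letters
below `B` it is strictly monotone for the lexicographic order. -/
def wordVal (B : ℕ) : List ℕ → ℕ
  | [] => 0
  | a :: x => a * B ^ x.length + wordVal B x

/-- The number `0.xxx…` in base `B` whose digits repeat the nonempty word `x`.
Comparing `slope x` with `slope y` amounts to comparing `x ++ y` with `y ++ x`. -/
def slope (B : ℕ) (x : List ℕ) : ℚ := wordVal B x / ((B : ℚ) ^ x.length - 1)

/-- The excess of the value of `x` over the value that a word of this length and slope `θ`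
would have. It is additive under concatenation up to a power of `B`. -/
def excess (B : ℕ) (θ : ℚ) (x : List ℕ) : ℚ := wordVal B x - θ * ((B : ℚ) ^ x.length - 1)

lemma wordVal_append (B : ℕ) (x y : List ℕ) :
    wordVal B (x ++ y) = wordVal B x * B ^ y.length + wordVal B y := by
  induction x with
  | nil => simp [wordVal]
  | cons a x ih => simp only [List.cons_append, wordVal, ih, List.length_append, pow_add]; ring

lemma excess_append (B : ℕ) (θ : ℚ) (x y : List ℕ) :
    excess B θ (x ++ y) = excess B θ x * (B : ℚ) ^ y.length + excess B θ y := by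
  simp only [excess, wordVal_append, List.length_append, pow_add]; push_cast; ring

@[simp] lemma excess_nil (B : ℕ) (θ : ℚ) : excess B θ [] = 0 := by simp [excess, wordVal]

lemma wordVal_lt (B : ℕ) (x : List ℕ) (hx : ∀ i ∈ x, i < B) : wordVal B x < B ^ x.length := by
  induction x with
  | nil => simp [wordVal]
  | cons a x ih =>
    have h1 := ih fun i hi => hx i (List.mem_cons_of_mem _ hi)
    have h2 : (a + 1) * B ^ x.length ≤ B * B ^ x.length :=
      Nat.mul_le_mul_right _ (hx a List.mem_cons_self)
    simp only [wordVal, List.length_cons, pow_succ']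
    linarith

lemma wordVal_lt_of_lt {B : ℕ} : ∀ {x y : List ℕ}, (∀ i ∈ x, i < B) →
    x.length = y.length → x < y → wordVal B x < wordVal B y
  | [], [], _, _, h => by simp at h
  | a :: x, b :: y, hx, hl, h => by
    have hl' : x.length = y.length := by simpa using hl
    have hx' : ∀ i ∈ x, i < B := fun i hi => hx i (List.mem_cons_of_mem _ hi)
    simp only [wordVal, ← hl']
    rcases List.cons_lt_cons_iff.1 h with h | ⟨rfl, h'⟩
    · have h1 := wordVal_lt B x hx'
      have h2 : (a + 1) * B ^ x.length ≤ b * B ^ x.length := Nat.mul_le_mul_right _ h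
      linarith
    · have := wordVal_lt_of_lt hx' hl' h'
      omega

lemma le_of_wordVal_le {B : ℕ} {x y : List ℕ} (hy : ∀ i ∈ y, i < B)
    (hl : x.length = y.length) (h : wordVal B x ≤ wordVal B y) : x ≤ y := by
  by_contra hlt
  have := wordVal_lt_of_lt hy hl.symm (lt_of_not_ge hlt)
  omega

lemma wordVal_le_of_le {B : ℕ} {x y : List ℕ} (hx : ∀ i ∈ x, i < B)
    (hl : x.length = y.length) (h : x ≤ y) : wordVal B x ≤ wordVal B y := by
  rcases h.lt_or_eq with h | rfl
  · exact (wordVal_lt_of_lt hx hl h).le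
  · exact le_rfl

lemma wordVal_injective {B : ℕ} {x y : List ℕ} (hx : ∀ i ∈ x, i < B) (hy : ∀ i ∈ y, i < B)
    (hl : x.length = y.length) (h : wordVal B x = wordVal B y) : x = y :=
  le_antisymm (le_of_wordVal_le hy hl h.le) (le_of_wordVal_le hx hl.symm h.ge)

lemma pow_sub_one_pos {B : ℕ} (hB : 2 ≤ B) {x : List ℕ} (hx : x ≠ []) :
    (0 : ℚ) < (B : ℚ) ^ x.length - 1 := by
  have : (1 : ℚ) < (B : ℚ) ^ x.length :=
    one_lt_pow₀ (by exact_mod_cast hB) (by simpa using hx)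
  linarith

lemma excess_eq {B : ℕ} (hB : 2 ≤ B) {x : List ℕ} (hx : x ≠ []) (θ : ℚ) :
    excess B θ x = (slope B x - θ) * ((B : ℚ) ^ x.length - 1) := by
  have := pow_sub_one_pos hB hx
  rw [excess, slope]; field_simp

lemma excess_nonneg_iff {B : ℕ} (hB : 2 ≤ B) {x : List ℕ} (hx : x ≠ []) (θ : ℚ) :
    0 ≤ excess B θ x ↔ θ ≤ slope B x := by
  rw [excess_eq hB hx, mul_nonneg_iff_of_pos_right (pow_sub_one_pos hB hx), sub_nonneg]

lemma excess_slope_self {B : ℕ} (hB : 2 ≤ B) {x : List ℕ} (hx : x ≠ []) :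
    excess B (slope B x) x = 0 := by
  rw [excess_eq hB hx]; simp

lemma slope_lt_iff {B : ℕ} (hB : 2 ≤ B) {x y : List ℕ} (hx : x ≠ []) (hy : y ≠ []) :
    slope B x < slope B y ↔ wordVal B (x ++ y) < wordVal B (y ++ x) := by
  have h1 := pow_sub_one_pos hB hx
  have h2 := pow_sub_one_pos hB hy
  rw [slope, slope, div_lt_div_iff₀ h1 h2, ← Nat.cast_lt (α := ℚ), wordVal_append, wordVal_append]
  push_cast
  constructor <;> intro h <;> linarith

lemma pow_length_pos {B : ℕ} (hB : 2 ≤ B) (x : List ℕ) : (0 : ℚ) < (B : ℚ) ^ x.length := by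
  have : 0 < B := by omega
  positivity

/-- If `v` has at most the slope of `s ++ v`, it has at most the slope of `s`. -/
lemma slope_le_of_le_append {B : ℕ} (hB : 2 ≤ B) {s v : List ℕ} (hs : s ≠ []) (hv : v ≠ [])
    (h : slope B v ≤ slope B (s ++ v)) : slope B v ≤ slope B s := by
  rw [← excess_nonneg_iff hB (by simp [hs]), excess_append, excess_slope_self hB hv, add_zero,
    mul_nonneg_iff_of_pos_right (pow_length_pos hB v)] at h
  exact (excess_nonneg_iff hB hs _).1 h

/-- If `p ++ s` has a smaller slope than `s`, so has `p`. -/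
lemma slope_lt_of_append_lt {B : ℕ} (hB : 2 ≤ B) {p s : List ℕ} (hp : p ≠ []) (hs : s ≠ [])
    (h : slope B (p ++ s) < slope B s) : slope B p < slope B s := by
  by_contra hle
  rw [not_lt] at hle
  refine absurd h (not_lt.2 ?_)
  rw [← excess_nonneg_iff hB (by simp [hp]), excess_append, excess_slope_self hB hs, add_zero]
  exact mul_nonneg ((excess_nonneg_iff hB hp _).2 hle) (pow_length_pos hB s).le

/-- Every nonempty word has a shortest suffix among those of minimal slope. -/
lemma exists_min_suffix (B : ℕ) (w : List ℕ) (hw : w ≠ []) :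
    ∃ u v, w = u ++ v ∧ v ≠ [] ∧ (∀ s, s <:+ w → s ≠ [] → slope B v ≤ slope B s) ∧
      ∀ s, s <:+ v → s ≠ [] → s ≠ v → slope B v < slope B s := by
  induction w with
  | nil => exact absurd rfl hw
  | cons a w ih =>
    rcases eq_or_ne w [] with rfl | hw'
    · refine ⟨[], [a], rfl, by simp, ?_, ?_⟩ <;> intro s hs <;>
        rcases List.suffix_cons_iff.1 hs with rfl | h <;> simp_all
    obtain ⟨u, v, rfl, hv, h1, h2⟩ := ih hw'
    by_cases hlt : slope B (a :: (u ++ v)) < slope B v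
    · refine ⟨[], a :: (u ++ v), rfl, by simp, ?_, ?_⟩
      · intro s hs hs0
        rcases List.suffix_cons_iff.1 hs with rfl | h
        · exact le_rfl
        · exact hlt.le.trans (h1 s h hs0)
      · intro s hs hs0 hne
        rcases List.suffix_cons_iff.1 hs with rfl | h
        · exact absurd rfl hne
        · exact hlt.trans_le (h1 s h hs0)
    · refine ⟨a :: u, v, rfl, hv, ?_, h2⟩
      intro s hs hs0
      rcases List.suffix_cons_iff.1 hs with rfl | h
      · exact not_lt.1 hlt
      · exact h1 s h hs0

/-! ### Lyndon words -/

/-- Words that commute are powers of a common word. -/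
lemma exists_common_root : ∀ (n : ℕ) (p s : List ℕ), p.length + s.length ≤ n → p ≠ [] → s ≠ [] →
    p ++ s = s ++ p → ∃ (u : List ℕ) (k l : ℕ), 0 < k ∧ 0 < l ∧
      p = (List.replicate k u).flatten ∧ s = (List.replicate l u).flatten := by
  -- Euclid's algorithm on the lengths: strip the shorter word from the longer one.
  have step : ∀ (p t : List ℕ), p ++ (p ++ t) = (p ++ t) ++ p → p ++ t = t ++ p := by
    intro p t h
    simpa [List.append_assoc] using h
  intro n
  induction n with
  | zero =>
    intro p s h hp
    simp_all
  | succ n ih =>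
    intro p s hn hp hs h
    have hp' := List.length_pos_iff.2 hp
    have hs' := List.length_pos_iff.2 hs
    rcases le_total p.length s.length with hle | hle
    · obtain ⟨t, rfl⟩ : p <+: s :=
        List.prefix_of_prefix_length_le (List.prefix_append p s) (h ▸ List.prefix_append s p) hle
      rcases eq_or_ne t [] with rfl | ht
      · exact ⟨p, 1, 1, one_pos, one_pos, by simp, by simp⟩
      · obtain ⟨u, k, l, hk, hl, h1, h2⟩ := ih p t (by simp at hn; omega) hp ht (step p t h)
        refine ⟨u, k, k + l, hk, by omega, h1, ?_⟩
        rw [List.replicate_add, List.flatten_append, ← h1, ← h2]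
    · obtain ⟨t, rfl⟩ : s <+: p :=
        List.prefix_of_prefix_length_le (List.prefix_append s p) (h.symm ▸ List.prefix_append p s)
          hle
      rcases eq_or_ne t [] with rfl | ht
      · exact ⟨s, 1, 1, one_pos, one_pos, by simp, by simp⟩
      · obtain ⟨u, k, l, hk, hl, h1, h2⟩ :=
          ih s t (by simp at hn; omega) hs ht (step s t h.symm)
        refine ⟨u, k + l, k, by omega, hk, ?_, h1⟩
        rw [List.replicate_add, List.flatten_append, ← h1, ← h2]

/-- A word is Lyndon if and only if, whenever it is cut into two nonempty parts, the first part
has the smaller slope. -/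
lemma isLyndon_iff {B : ℕ} (hB : 2 ≤ B) {w : List ℕ} (hw : ∀ i ∈ w, i < B) :
    IsLyndon w ↔ w ≠ [] ∧ ∀ p s, p ≠ [] → s ≠ [] → w = p ++ s → slope B p < slope B s := by
  constructor
  · rintro ⟨h0, hprim, hmin⟩
    refine ⟨h0, fun p s hp hs hps => ?_⟩
    subst hps
    have hsp : ∀ i ∈ s ++ p, i < B := fun i hi => hw i (by simp at hi ⊢; tauto)
    have hlen : (p ++ s).length = (s ++ p).length := by simp [add_comm]
    rw [slope_lt_iff hB hp hs]
    refine lt_of_le_of_ne (wordVal_le_of_le hw hlen (hmin p s rfl)) fun heq => ?_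
    obtain ⟨u, k, l, hk, hl, h1, h2⟩ :=
      exists_common_root _ p s le_rfl hp hs (wordVal_injective hw hsp hlen heq)
    have hu : u = p ++ s := by
      refine hprim u (k + l) ?_
      rw [List.replicate_add, List.flatten_append, ← h1, ← h2]
    have e1 : p.length = k * u.length := by rw [h1]; simp
    have e2 : u.length = p.length + s.length := by rw [hu]; simp
    have := List.length_pos_iff.2 hs
    have : u.length ≤ k * u.length := Nat.le_mul_of_pos_left _ hk
    omega
  · rintro ⟨h0, h⟩
    refine ⟨h0, ?_, ?_⟩
    · intro u k hk
      match k with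
      | 0 => simp at hk; exact absurd hk h0
      | 1 => simpa using hk.symm
      | k + 2 =>
        have hu : u ≠ [] := by
          rintro rfl
          simp at hk; exact h0 hk
        have hc := h u (List.replicate (k + 1) u).flatten hu (by simp [hu])
          (by rw [hk, List.replicate_succ, List.flatten_cons])
        rw [slope_lt_iff hB hu (by simp [hu])] at hc
        have e : u ++ (List.replicate (k + 1) u).flatten =
            (List.replicate (k + 1) u).flatten ++ u := by
          conv_lhs => rw [← List.flatten_cons, ← List.replicate_succ]
          rw [List.replicate_succ', List.flatten_append]; simp
        rw [e] at hc
        exact absurd hc (lt_irrefl _)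
    · rintro a b rfl
      rcases eq_or_ne a [] with rfl | ha
      · simp
      rcases eq_or_ne b [] with rfl | hb
      · simp
      refine le_of_wordVal_le (B := B) (fun i hi => hw i (by simp at hi ⊢; tauto))
        (by simp [add_comm]) ?_
      exact ((slope_lt_iff hB ha hb).1 (h a b ha hb rfl)).le

/-- A word whose slope is smaller than that of all its proper suffixes is Lyndon. -/
lemma isLyndon_of_slope_lt {B : ℕ} (hB : 2 ≤ B) {v : List ℕ} (hv : v ≠ [])
    (hvB : ∀ i ∈ v, i < B) (h : ∀ s, s <:+ v → s ≠ [] → s ≠ v → slope B v < slope B s) :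
    IsLyndon v := by
  refine (isLyndon_iff hB hvB).2 ⟨hv, ?_⟩
  rintro p s hp hs rfl
  exact slope_lt_of_append_lt hB hp hs (h s (List.suffix_append p s) hs (by simpa using hp))

/-- A Lyndon word with at least two letters is the concatenation of two Lyndon words. The second
one can be taken to be the shortest proper suffix of minimal slope. -/
lemma IsLyndon.exists_factorization {B : ℕ} (hB : 2 ≤ B) {w : List ℕ} (hwB : ∀ i ∈ w, i < B)
    (hw : IsLyndon w) (h2 : 2 ≤ w.length) :
    ∃ u v, w = u ++ v ∧ IsLyndon u ∧ IsLyndon v := by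
  have hl := ((isLyndon_iff hB hwB).1 hw).2
  match w, h2 with
  | a :: w', h2 =>
    obtain ⟨u, v, rfl, hv, h1, h3⟩ := exists_min_suffix B w' (by rintro rfl; simp at h2)
    refine ⟨a :: u, v, rfl, ?_, ?_⟩
    · refine (isLyndon_iff hB fun i hi => hwB i (by simp at hi ⊢; tauto)).2 ⟨by simp, ?_⟩
      intro p s hp hs hps
      -- `s` is a suffix of `u`, because `p` is not empty.
      obtain ⟨t, ht⟩ : s <:+ u := by
        rcases List.suffix_cons_iff.1 (hps ▸ List.suffix_append p s) with h | h
        · rw [← h] at hps; simp at hps; exact absurd hps hp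
        · exact h
      have hsv : slope B v ≤ slope B s := slope_le_of_le_append hB hs hv
        (h1 (s ++ v) ⟨t, by rw [← List.append_assoc, ht]⟩ (by simp [hs]))
      have huv : slope B (p ++ s) < slope B v :=
        hl (p ++ s) v (by simp [hp]) hv (by rw [← hps]; rfl)
      exact slope_lt_of_append_lt hB hp hs (huv.trans_le hsv)
    · exact isLyndon_of_slope_lt hB hv (fun i hi => hwB i (by simp; tauto)) h3

/-! ### Shuffles -/

/-- The list of all shuffles of two words, with multiplicities. -/
def shuffles {T : Type*} : List T → List T → List (List T)
  | [], v => [v]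
  | a :: u, [] => [a :: u]
  | a :: u, b :: v =>
    (shuffles u (b :: v)).map (List.cons a) ++ (shuffles (a :: u) v).map (List.cons b)
termination_by u v => u.length + v.length

/-- The value on the shuffle product of two words of the linear extension of a function of words. -/
def shuffleSum {T K : Type*} [AddMonoid K] (f : List T → K) (u v : List T) : K :=
  ((shuffles u v).map f).sum

section Shuffles

variable {T K : Type*}

@[simp] lemma shuffles_nil_left (v : List T) : shuffles [] v = [v] := by simp [shuffles]

@[simp] lemma shuffles_nil_right (u : List T) : shuffles u [] = [u] := by
  cases u <;> simp [shuffles]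

lemma shuffles_cons_cons (a b : T) (u v : List T) : shuffles (a :: u) (b :: v) =
    (shuffles u (b :: v)).map (List.cons a) ++ (shuffles (a :: u) v).map (List.cons b) := by
  rw [shuffles]

@[simp] lemma shuffleSum_nil_left [AddMonoid K] (f : List T → K) (v : List T) :
    shuffleSum f [] v = f v := by simp [shuffleSum]

@[simp] lemma shuffleSum_nil_right [AddMonoid K] (f : List T → K) (u : List T) :
    shuffleSum f u [] = f u := by simp [shuffleSum]

lemma shuffleSum_cons_cons [AddMonoid K] (f : List T → K) (a b : T) (u v : List T) :
    shuffleSum f (a :: u) (b :: v) = shuffleSum (fun x => f (a :: x)) u (b :: v) +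
      shuffleSum (fun x => f (b :: x)) (a :: u) v := by
  simp [shuffleSum, shuffles_cons_cons, Function.comp_def]

lemma shuffleSum_add [AddCommMonoid K] (f g : List T → K) (u v : List T) :
    shuffleSum (fun x => f x + g x) u v = shuffleSum f u v + shuffleSum g u v := by
  simp [shuffleSum, List.sum_map_add]

lemma shuffleSum_mul_left [Semiring K] (k : K) (f : List T → K) (u v : List T) :
    shuffleSum (fun x => k * f x) u v = k * shuffleSum f u v := by
  simp [shuffleSum, List.sum_map_mul_left]

lemma perm_of_mem_shuffles (u v z : List T) (hz : z ∈ shuffles u v) : z.Perm (u ++ v) := by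
  match u, v with
  | [], v => simp_all
  | a :: u, [] => simp_all
  | a :: u, b :: v =>
    rw [shuffles_cons_cons, List.mem_append, List.mem_map, List.mem_map] at hz
    rcases hz with ⟨x, hx, rfl⟩ | ⟨x, hx, rfl⟩
    · exact (perm_of_mem_shuffles u (b :: v) x hx).cons a
    · exact ((perm_of_mem_shuffles (a :: u) v x hx).cons b).trans
        (List.perm_middle (l₁ := a :: u)).symm
termination_by u.length + v.length

lemma append_mem_shuffles (u v : List T) : u ++ v ∈ shuffles u v := by
  match u, v with
  | [], v => simp
  | a :: u, [] => simp
  | a :: u, b :: v =>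
    rw [shuffles_cons_cons, List.cons_append, List.mem_append]
    exact Or.inl (List.mem_map_of_mem (append_mem_shuffles u (b :: v)))
termination_by u.length + v.length

lemma length_shuffles (u v : List T) :
    (shuffles u v).length = (u.length + v.length).choose u.length := by
  match u, v with
  | [], v => simp
  | a :: u, [] => simp
  | a :: u, b :: v =>
    have h1 := length_shuffles u (b :: v)
    have h2 := length_shuffles (a :: u) v
    simp only [List.length_cons] at h1 h2
    rw [shuffles_cons_cons, List.length_append, List.length_map, List.length_map, h1, h2,
      List.length_cons, List.length_cons,
      show u.length + 1 + (v.length + 1) = (u.length + (v.length + 1)) + 1 by ring,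
      Nat.choose_succ_succ,
      show u.length + 1 + v.length = u.length + (v.length + 1) by ring]
termination_by u.length + v.length

end Shuffles

/-! ### Deconcatenation and characters of the shuffle algebra -/

/-- The product of two functions of words that is dual to the deconcatenation of words; these are
the coefficients of the product of two noncommutative power series. -/
def convolution {T K : Type*} [Semiring K] (f g : List T → K) (w : List T) : K :=
  ∑ i ∈ Finset.range (w.length + 1), f (w.take i) * g (w.drop i)

/-- Multiplicative functionals on the shuffle algebra, that is, coefficient functions of group-like
noncommutative power series. -/
def IsShuffleCharacter {T K : Type*} [Semiring K] (f : List T → K) : Prop :=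
  f [] = 1 ∧ ∀ u v, shuffleSum f u v = f u * f v

section Convolution

variable {T K : Type*}

lemma convolution_cons [Semiring K] (f g : List T → K) (a : T) (w : List T) :
    convolution f g (a :: w) = f [] * g (a :: w) + convolution (fun x => f (a :: x)) g w := by
  rw [convolution, List.length_cons, Finset.sum_range_succ', add_comm]
  simp [convolution]

@[simp] lemma convolution_nil [Semiring K] (f g : List T → K) :
    convolution f g [] = f [] * g [] := by simp [convolution]

/-- If `s` satisfies the recursion of the shuffle product, in which the first letter comes from
either word, a sum over pairs of cuts splits in the same way. -/
lemma sum_range_mul_shift [CommSemiring K] (s α β G : ℕ → ℕ → K) (M N : ℕ)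
    (h1 : ∀ i, s (i + 1) 0 = α i 0) (h2 : ∀ j, s 0 (j + 1) = β 0 j)
    (h3 : ∀ i j, s (i + 1) (j + 1) = α i (j + 1) + β (i + 1) j) :
    ∑ i ∈ Finset.range (M + 1), ∑ j ∈ Finset.range (N + 1), s i j * G i j =
      s 0 0 * G 0 0 + ∑ i ∈ Finset.range M, ∑ j ∈ Finset.range (N + 1), α i j * G (i + 1) j +
        ∑ i ∈ Finset.range (M + 1), ∑ j ∈ Finset.range N, β i j * G i (j + 1) := by
  simp only [Finset.sum_range_succ', h1, h2, h3, add_mul, Finset.sum_add_distrib]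
  ring

/-- Deconcatenation is a homomorphism for the shuffle product. -/
lemma shuffleSum_convolution [CommSemiring K] (f g : List T → K) (u v : List T) :
    shuffleSum (convolution f g) u v = ∑ i ∈ Finset.range (u.length + 1),
      ∑ j ∈ Finset.range (v.length + 1),
        shuffleSum f (u.take i) (v.take j) * shuffleSum g (u.drop i) (v.drop j) := by
  match u, v with
  | [], v => simp [convolution]
  | a :: u, [] => simp [convolution]
  | a :: u, b :: v =>
    have key := sum_range_mul_shift
      (fun i j => shuffleSum f ((a :: u).take i) ((b :: v).take j))
      (fun i j => shuffleSum (fun x => f (a :: x)) (u.take i) ((b :: v).take j))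
      (fun i j => shuffleSum (fun x => f (b :: x)) ((a :: u).take i) (v.take j))
      (fun i j => shuffleSum g ((a :: u).drop i) ((b :: v).drop j)) (u.length + 1) (v.length + 1)
      (by simp) (by simp) (by simp [shuffleSum_cons_cons])
    rw [List.length_cons, List.length_cons, key, shuffleSum_cons_cons]
    simp only [convolution_cons, shuffleSum_add, shuffleSum_mul_left,
      shuffleSum_convolution _ g u (b :: v), shuffleSum_convolution _ g (a :: u) v]
    simp only [List.length_cons, List.take_zero, List.drop_zero, List.drop_succ_cons,
      shuffleSum_nil_left, shuffleSum_cons_cons g]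
    ring
termination_by u.length + v.length

lemma IsShuffleCharacter.convolution [CommSemiring K] {f g : List T → K}
    (hf : IsShuffleCharacter f) (hg : IsShuffleCharacter g) :
    IsShuffleCharacter (convolution f g) := by
  refine ⟨by simp [hf.1, hg.1], fun u v => ?_⟩
  rw [shuffleSum_convolution, HigherOrderDecomposition.convolution,
    HigherOrderDecomposition.convolution, Finset.sum_mul_sum]
  refine Finset.sum_congr rfl fun i _ => Finset.sum_congr rfl fun j _ => ?_
  rw [hf.2, hg.2]; ring

/-- The coefficients of the exponential of `∑ i, a i • (letter i)`. -/
def expCoeff [Field K] (a : T → K) (w : List T) : K :=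
  ((w.length.factorial : K)⁻¹) * (w.map a).prod

lemma expCoeff_perm [Field K] (a : T → K) {w w' : List T} (h : w.Perm w') :
    expCoeff a w = expCoeff a w' := by
  rw [expCoeff, expCoeff, h.length_eq, (h.map a).prod_eq]

lemma isShuffleCharacter_expCoeff [Field K] [CharZero K] (a : T → K) :
    IsShuffleCharacter (expCoeff a) := by
  refine ⟨by simp [expCoeff], fun u v => ?_⟩
  have h : (shuffles u v).map (expCoeff a) = (shuffles u v).map fun _ => expCoeff a (u ++ v) :=
    List.map_congr_left fun z hz => expCoeff_perm a (perm_of_mem_shuffles u v z hz)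
  have h1 : (u.length.factorial : K) ≠ 0 := by exact_mod_cast Nat.factorial_ne_zero _
  have h2 : (v.length.factorial : K) ≠ 0 := by exact_mod_cast Nat.factorial_ne_zero _
  have h3 : ((u.length + v.length).factorial : K) ≠ 0 := by
    exact_mod_cast Nat.factorial_ne_zero _
  rw [shuffleSum, h, List.map_const', List.sum_replicate, length_shuffles, nsmul_eq_mul,
    Nat.cast_add_choose]
  simp only [expCoeff, List.length_append, List.map_append, List.prod_append]
  field_simp

/-- The trivial character, the unit for the convolution. -/
def unitCoeff [Semiring K] (w : List T) : K := if w.isEmpty then 1 else 0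

lemma isShuffleCharacter_unitCoeff [Semiring K] :
    IsShuffleCharacter (unitCoeff : List T → K) := by
  refine ⟨rfl, fun u v => ?_⟩
  match u, v with
  | [], v => simp [unitCoeff]
  | a :: u, [] => simp [unitCoeff]
  | a :: u, b :: v =>
    rw [shuffleSum_cons_cons]
    simp [unitCoeff, shuffleSum]

/-- The identity satisfied by the antipode of the shuffle algebra, in the form of a telescoping
sum: `s` is the reversal of the part of the word that has already been cut off. -/
lemma sum_neg_one_pow_shuffleSum_reverse_cons [CommRing K] (f : List T → K) (x : T)
    (s v : List T) :
    ∑ i ∈ Finset.range (v.length + 1),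
      (-1) ^ i * shuffleSum f ((v.take i).reverse ++ x :: s) (v.drop i) =
        shuffleSum (fun z => f (x :: z)) s v := by
  induction v generalizing x s with
  | nil => simp
  | cons y v ih =>
    rw [List.length_cons, Finset.sum_range_succ']
    have := ih y (x :: s)
    simp only [List.take_succ_cons, List.reverse_cons, List.append_assoc, List.singleton_append,
      List.drop_succ_cons, pow_succ, mul_neg_one, neg_mul, Finset.sum_neg_distrib, this,
      List.take_zero, List.reverse_nil, List.nil_append, List.drop_zero, pow_zero, one_mul,
      shuffleSum_cons_cons]
    ring

lemma sum_neg_one_pow_shuffleSum_reverse [CommRing K] (f : List T → K) {w : List T}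
    (hw : w ≠ []) :
    ∑ i ∈ Finset.range (w.length + 1),
      (-1) ^ i * shuffleSum f (w.take i).reverse (w.drop i) = 0 := by
  match w, hw with
  | y :: v, _ =>
    rw [List.length_cons, Finset.sum_range_succ']
    have := sum_neg_one_pow_shuffleSum_reverse_cons f y [] v
    simp only [List.take_succ_cons, List.reverse_cons,
      List.drop_succ_cons, pow_succ, mul_neg_one, neg_mul, Finset.sum_neg_distrib, this,
      List.take_zero, List.reverse_nil, List.drop_zero, pow_zero, one_mul,
      shuffleSum_nil_left]
    ring

/-- Reversal of words reverses convolutions. -/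
lemma convolution_reverse [CommSemiring K] (f g : List T → K) (w : List T) :
    convolution f g w.reverse =
      convolution (fun x => g x.reverse) (fun x => f x.reverse) w := by
  rw [convolution, convolution, List.length_reverse, ← Finset.sum_range_reflect]
  refine Finset.sum_congr rfl fun i hi => ?_
  have hi' : i ≤ w.length := by simpa [Nat.lt_succ_iff] using hi
  rw [List.reverse_take, List.reverse_drop, mul_comm]
  rfl

end Convolution

/-! ### Lyndon words determine functionals vanishing on proper shuffles -/

/-- If all suffixes of `u` and `v` have nonnegative excess, the excess of a shuffle of `u` and `v`
is at most what it would be if every letter of either word came before all letters of the other. -/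
lemma excess_le_of_mem_shuffles {B : ℕ} (hB : 2 ≤ B) (θ : ℚ) (u v z : List ℕ)
    (hz : z ∈ shuffles u v) (hu : ∀ s, s <:+ u → 0 ≤ excess B θ s)
    (hv : ∀ s, s <:+ v → 0 ≤ excess B θ s) :
    excess B θ z ≤ (B : ℚ) ^ v.length * excess B θ u + (B : ℚ) ^ u.length * excess B θ v := by
  have hB1 : (1 : ℚ) ≤ B := by exact_mod_cast le_trans one_le_two hB
  have cons_eq : ∀ (a : ℕ) (x : List ℕ),
      excess B θ (a :: x) = excess B θ [a] * (B : ℚ) ^ x.length + excess B θ x :=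
    fun a x => excess_append B θ [a] x
  match u, v with
  | [], v =>
    rw [shuffles_nil_left, List.mem_singleton] at hz
    simp [hz]
  | a :: u, [] =>
    rw [shuffles_nil_right, List.mem_singleton] at hz
    simp [hz]
  | a :: u, b :: v =>
    have hau := hu _ List.suffix_rfl
    have hbv := hv _ List.suffix_rfl
    have hpow (n : ℕ) : (B : ℚ) ^ n ≤ (B : ℚ) ^ (n + 1) := pow_le_pow_right₀ hB1 n.le_succ
    rw [shuffles_cons_cons, List.mem_append, List.mem_map, List.mem_map] at hz
    rcases hz with ⟨x, hx, rfl⟩ | ⟨x, hx, rfl⟩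
    · have ih := excess_le_of_mem_shuffles hB θ u (b :: v) x hx
        (fun s hs => hu s (hs.trans (List.suffix_cons a u))) hv
      have hl := (perm_of_mem_shuffles _ _ _ hx).length_eq
      have h := mul_le_mul_of_nonneg_right (hpow u.length) hbv
      rw [cons_eq a x, cons_eq a u, hl, List.length_append, pow_add, List.length_cons (as := u)]
      linarith
    · have ih := excess_le_of_mem_shuffles hB θ (a :: u) v x hx hu
        (fun s hs => hv s (hs.trans (List.suffix_cons b v)))
      have hl := (perm_of_mem_shuffles _ _ _ hx).length_eq
      have h := mul_le_mul_of_nonneg_right (hpow v.length) hau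
      rw [cons_eq b x, cons_eq b v, hl, List.length_append, pow_add, List.length_cons (as := v)]
      linarith
termination_by u.length + v.length

/-- A nonempty word is Lyndon, or it can be cut into two nonempty parts in such a way that it is
the largest shuffle of these parts: cut off the shortest suffix of minimal slope. -/
lemma isLyndon_or_exists_split {B : ℕ} (hB : 2 ≤ B) {w : List ℕ} (hw : w ≠ [])
    (hwB : ∀ i ∈ w, i < B) :
    IsLyndon w ∨ ∃ u v, u ≠ [] ∧ v ≠ [] ∧ w = u ++ v ∧
      ∀ z ∈ shuffles u v, wordVal B z ≤ wordVal B w := by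
  obtain ⟨u, v, rfl, hv, h1, h2⟩ := exists_min_suffix B w hw
  rcases eq_or_ne u [] with rfl | hu
  · exact Or.inl (isLyndon_of_slope_lt hB hv hwB h2)
  refine Or.inr ⟨u, v, hu, hv, rfl, fun z hz => ?_⟩
  have hl := (perm_of_mem_shuffles _ _ _ hz).length_eq
  have key := excess_le_of_mem_shuffles hB (slope B v) u v z hz ?_ ?_
  · rw [excess_slope_self hB hv, mul_zero, add_zero] at key
    have e : excess B (slope B v) (u ++ v) = (B : ℚ) ^ v.length * excess B (slope B v) u := by
      rw [excess_append, excess_slope_self hB hv]; ring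
    rw [← e, excess, excess, hl] at key
    exact_mod_cast (sub_le_sub_iff_right _).1 key
  · rintro s ⟨t, rfl⟩
    rcases eq_or_ne s [] with rfl | hs
    · simp
    exact (excess_nonneg_iff hB hs _).2 (slope_le_of_le_append hB hs hv
      (h1 (s ++ v) ⟨t, by simp⟩ (by simp [hs])))
  · intro s hs
    rcases eq_or_ne s [] with rfl | hs0
    · simp
    exact (excess_nonneg_iff hB hs0 _).2 (h1 s (hs.trans (List.suffix_append u v)) hs0)

lemma exists_letter_bound (w : List ℕ) : ∃ B, 2 ≤ B ∧ ∀ i ∈ w, i < B :=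
  ⟨w.sum + 2, by omega, fun i hi => by have := List.single_le_sum (by simp) i hi; omega⟩

/-- A functional that vanishes on the proper shuffles and on the Lyndon words of some content
vanishes on all words of this content. -/
lemma eq_zero_of_lyndon {K : Type*} [Field K] [CharZero K] (f : List ℕ → K) (w : List ℕ)
    (hw : w ≠ [])
    (hsh : ∀ u v, u ≠ [] → v ≠ [] → (u ++ v).Perm w → shuffleSum f u v = 0)
    (hl : ∀ l, l.Perm w → IsLyndon l → f l = 0) : f w = 0 := by
  obtain ⟨B, hB, hwB⟩ := exists_letter_bound w
  suffices H : ∀ (n : ℕ) (x : List ℕ), x.Perm w → wordVal B x = n → f x = 0 from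
    H _ w (List.Perm.refl w) rfl
  intro n
  induction n using Nat.strong_induction_on with
  | _ n ih =>
    rintro x hx rfl
    have hB' : ∀ {y : List ℕ}, y.Perm w → ∀ i ∈ y, i < B :=
      fun hy i hi => hwB i (hy.mem_iff.1 hi)
    have hx0 : x ≠ [] := by rintro rfl; exact hw (List.nil_perm.1 hx)
    rcases isLyndon_or_exists_split hB hx0 (hB' hx) with h | ⟨u, v, hu, hv, rfl, hmax⟩
    · exact hl x hx h
    have h0 := hsh u v hu hv hx
    have hf : ∀ z, z ≠ u ++ v → z ∈ shuffles u v → f z = 0 := by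
      intro z hzw hz
      have hzp := perm_of_mem_shuffles u v z hz
      refine ih _ (lt_of_le_of_ne (hmax z hz) fun heq => hzw ?_) z (hzp.trans hx) rfl
      exact wordVal_injective (hB' (hzp.trans hx)) (hB' hx) hzp.length_eq heq
    rw [shuffleSum, List.sum_map_eq_nsmul_single (u ++ v) f hf, smul_eq_zero] at h0
    exact h0.resolve_left fun h => by
      rw [@List.count_eq_zero _ instBEqOfDecidableEq] at h
      exact h (append_mem_shuffles u v)

/-! ### Coefficients of noncommutative polynomials -/

section Coefficients

variable {K T : Type*} [Field K]

@[simp] lemma wordCoeff_zero (w : List T) : wordCoeff (0 : WordAlgebra K T) w = 0 := rfl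

@[simp] lemma wordCoeff_add (P Q : WordAlgebra K T) (w : List T) :
    wordCoeff (P + Q) w = wordCoeff P w + wordCoeff Q w := rfl

@[simp] lemma wordCoeff_sub (P Q : WordAlgebra K T) (w : List T) :
    wordCoeff (P - Q) w = wordCoeff P w - wordCoeff Q w := by
  simp [wordCoeff, sub_eq_add_neg, MonoidAlgebra.coeff_add, MonoidAlgebra.coeff_neg]

@[simp] lemma wordCoeff_smul (a : K) (P : WordAlgebra K T) (w : List T) :
    wordCoeff (a • P) w = a * wordCoeff P w := rfl

lemma wordAlgebra_ext {P Q : WordAlgebra K T} (h : ∀ w, wordCoeff P w = wordCoeff Q w) :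
    P = Q :=
  MonoidAlgebra.ext (Finsupp.ext fun w => h (FreeMonoid.toList w))

lemma wordCoeff_word [DecidableEq T] (u w : List T) :
    wordCoeff (word K u) w = if u = w then 1 else 0 := by
  classical
  rw [wordCoeff, word, MonoidAlgebra.coeff_single, Finsupp.single_apply]
  simp only [FreeMonoid.ofList.injective.eq_iff]

lemma word_append (u v : List T) : word K (u ++ v) = word K u * word K v := by
  simp [word, MonoidAlgebra.single_mul_single]

/-- The coefficients of a product of polynomials are the convolution of their coefficients. -/
lemma wordCoeff_mul (P Q : WordAlgebra K T) (w : List T) :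
    wordCoeff (P * Q) w = convolution (wordCoeff P) (wordCoeff Q) w := by
  classical
  rw [wordCoeff, MonoidAlgebra.coeff_mul_antidiag P Q (FreeMonoid.ofList w)
    ((Finset.range (w.length + 1)).image fun i =>
      (FreeMonoid.ofList (w.take i), FreeMonoid.ofList (w.drop i))), Finset.sum_image]
  · rfl
  · intro i hi j hj h
    have h' : w.take i = w.take j := congrArg (fun p => FreeMonoid.toList p.1) h
    have := congrArg List.length h'
    simp at hi hj this
    omega
  · rintro ⟨a, b⟩
    simp only [Finset.mem_image, Finset.mem_range, Prod.mk.injEq]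
    constructor
    · rintro ⟨i, -, rfl, rfl⟩
      rw [← FreeMonoid.ofList_append, List.take_append_drop]
    · intro h
      have hw : w = FreeMonoid.toList a ++ FreeMonoid.toList b :=
        (congrArg FreeMonoid.toList h).symm
      refine ⟨(FreeMonoid.toList a).length, by rw [hw, List.length_append]; omega, ?_, ?_⟩ <;>
        simp [hw]

end Coefficients

/-! ### Content -/

lemma HasContent.perm {w w' : List ℕ} {n : ℕ →₀ ℕ} (h : HasContent w n) (h' : HasContent w' n) :
    w.Perm w' := List.perm_iff_count.2 fun i => (h i).trans (h' i).symm

lemma HasContent.of_perm {w w' : List ℕ} {n : ℕ →₀ ℕ} (h : HasContent w n) (hp : w'.Perm w) :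
    HasContent w' n := fun i => (hp.count_eq i).trans (h i)

lemma exists_hasContent (n : ℕ →₀ ℕ) : ∃ w, HasContent w n := by
  refine ⟨n.toMultiset.toList, fun i => ?_⟩
  rw [← Multiset.coe_count, Multiset.coe_toList, Finsupp.count_toMultiset]

lemma hasContent_toFinsupp (w : List ℕ) : HasContent w (Multiset.toFinsupp (w : Multiset ℕ)) := by
  intro i
  simp

/-! ### Lie elements -/

section Lie

attribute [local instance] LieRing.ofAssociativeRing

variable {K : Type*} [Field K]

/-- The free Lie algebra on the letters, inside the free associative algebra. -/
abbrev freeLie (K : Type*) [Field K] : LieSubalgebra K (WordAlgebra K ℕ) :=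
  LieSubalgebra.lieSpan K (WordAlgebra K ℕ) (Set.range fun i : ℕ => word K [i])

/-- For primitive functionals only two terms of the deconcatenation survive on a proper
shuffle. -/
lemma shuffleSum_convolution_of_primitive {f g : List ℕ → K} (hf0 : f [] = 0)
    (hf : ∀ u v, u ≠ [] → v ≠ [] → shuffleSum f u v = 0)
    (hg : ∀ u v, u ≠ [] → v ≠ [] → shuffleSum g u v = 0) {u v : List ℕ}
    (hu : u ≠ []) (hv : v ≠ []) :
    shuffleSum (convolution f g) u v = f v * g u + f u * g v := by
  have hu' := List.length_pos_iff.2 hu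
  have hv' := List.length_pos_iff.2 hv
  have hF : ∀ i j, i ≠ 0 → j ≠ 0 → shuffleSum f (u.take i) (v.take j) = 0 :=
    fun i j hi hj => hf _ _ (by simp [hi, hu]) (by simp [hj, hv])
  have hG : ∀ i j, i < u.length → j < v.length → shuffleSum g (u.drop i) (v.drop j) = 0 :=
    fun i j hi hj => hg _ _ (by simp; omega) (by simp; omega)
  rw [shuffleSum_convolution, Finset.sum_range_succ', Finset.sum_eq_single_of_mem (u.length - 1)
    (by simp; omega), Finset.sum_eq_single_of_mem 0 (by simp),
    Finset.sum_eq_single_of_mem v.length (by simp)]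
  · have : u.length - 1 + 1 = u.length := by omega
    simp [this]; ring
  · intro j hj hne
    rcases eq_or_ne j 0 with rfl | hj0
    · simp [hf0]
    · rw [hG 0 j hu' (by simp at hj; omega), mul_zero]
  · intro j hj hne
    rw [hF _ _ (by omega) hne, zero_mul]
  · intro i hi hne
    refine Finset.sum_eq_zero fun j hj => ?_
    rcases eq_or_ne j 0 with rfl | hj0
    · rw [hG (i + 1) 0 (by simp at hi; omega) hv', mul_zero]
    · rw [hF _ _ (by omega) hj0, zero_mul]

/-- The easy half of Ree's theorem: the coefficients of a Lie element vanish on proper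
shuffles. -/
lemma shuffleSum_of_mem_freeLie {P : WordAlgebra K ℕ} (hP : P ∈ freeLie K) :
    wordCoeff P [] = 0 ∧ ∀ u v, u ≠ [] → v ≠ [] → shuffleSum (wordCoeff P) u v = 0 := by
  have hadd : ∀ (P Q : WordAlgebra K ℕ) u v, shuffleSum (wordCoeff (P + Q)) u v =
      shuffleSum (wordCoeff P) u v + shuffleSum (wordCoeff Q) u v :=
    fun P Q u v => shuffleSum_add _ _ u v
  have hsmul : ∀ (a : K) (P : WordAlgebra K ℕ) u v, shuffleSum (wordCoeff (a • P)) u v =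
      a * shuffleSum (wordCoeff P) u v :=
    fun a P u v => shuffleSum_mul_left a _ u v
  let L : LieSubalgebra K (WordAlgebra K ℕ) :=
    { carrier := {P | wordCoeff P [] = 0 ∧
        ∀ u v, u ≠ [] → v ≠ [] → shuffleSum (wordCoeff P) u v = 0}
      add_mem' := fun {P Q} hP hQ => ⟨by simp [hP.1, hQ.1], fun u v hu hv => by
        rw [hadd, hP.2 u v hu hv, hQ.2 u v hu hv, add_zero]⟩
      zero_mem' := ⟨rfl, fun u v _ _ => by
        have := hsmul 0 0 u v
        rwa [zero_smul, zero_mul] at this⟩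
      smul_mem' := fun a P hP => ⟨by simp [hP.1], fun u v hu hv => by
        rw [hsmul, hP.2 u v hu hv, mul_zero]⟩
      lie_mem' := fun {P Q} hP hQ => by
        have hc : ∀ P Q : WordAlgebra K ℕ, wordCoeff (P * Q) =
          convolution (wordCoeff P) (wordCoeff Q) := fun P Q => funext (wordCoeff_mul P Q)
        rw [Ring.lie_def]
        refine ⟨by simp [hc, hP.1], fun u v hu hv => ?_⟩
        have : P * Q - Q * P = P * Q + (-1 : K) • (Q * P) := by
          rw [neg_smul, one_smul, sub_eq_add_neg]
        rw [this, hadd, hsmul, hc, hc,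
          shuffleSum_convolution_of_primitive hP.1 hP.2 hQ.2 hu hv,
          shuffleSum_convolution_of_primitive hQ.1 hQ.2 hP.2 hu hv]
        ring }
  have hle : freeLie K ≤ L := by
    refine LieSubalgebra.lieSpan_le.2 ?_
    rintro _ ⟨i, rfl⟩
    refine ⟨by simp [wordCoeff_word], fun u v hu hv => ?_⟩
    refine List.sum_eq_zero fun x hx => ?_
    obtain ⟨z, hz, rfl⟩ := List.mem_map.1 hx
    have hl := (perm_of_mem_shuffles u v z hz).length_eq
    have hu' := List.length_pos_iff.2 hu
    have hv' := List.length_pos_iff.2 hv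
    rw [wordCoeff_word, if_neg]
    rintro rfl
    simp at hl
    omega
  exact hle hP

/-- Every Lyndon word is the smallest word of some Lie element (its standard bracketing), in which
it has coefficient `1`. -/
lemma exists_lyndon_bracket {B : ℕ} (hB : 2 ≤ B) (l : List ℕ) (hlB : ∀ i ∈ l, i < B)
    (hl : IsLyndon l) : ∃ P ∈ freeLie K, wordCoeff P l = 1 ∧
      ∀ w, wordCoeff P w ≠ 0 → w.Perm l ∧ wordVal B l ≤ wordVal B w := by
  by_cases h2 : 2 ≤ l.length
  · obtain ⟨u, v, rfl, hu, hv⟩ := hl.exists_factorization hB hlB h2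
    have hu' := List.length_pos_iff.2 hu.1
    have hv' := List.length_pos_iff.2 hv.1
    obtain ⟨P, hP, hP1, hPw⟩ := exists_lyndon_bracket hB u
      (fun i hi => hlB i (List.mem_append_left _ hi)) hu
    obtain ⟨Q, hQ, hQ1, hQw⟩ := exists_lyndon_bracket hB v
      (fun i hi => hlB i (List.mem_append_right _ hi)) hv
    -- The words of a product of two polynomials with known smallest words.
    have hmul : ∀ (P Q : WordAlgebra K ℕ) (u v : List ℕ),
        (∀ w, wordCoeff P w ≠ 0 → w.Perm u ∧ wordVal B u ≤ wordVal B w) →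
        (∀ w, wordCoeff Q w ≠ 0 → w.Perm v ∧ wordVal B v ≤ wordVal B w) →
        ∀ w, wordCoeff (P * Q) w ≠ 0 → w.Perm (u ++ v) ∧ wordVal B (u ++ v) ≤ wordVal B w := by
      intro P Q u v hP hQ w hw
      rw [wordCoeff_mul] at hw
      obtain ⟨i, -, hi⟩ := Finset.exists_ne_zero_of_sum_ne_zero hw
      obtain ⟨h1, h2⟩ := hP _ (left_ne_zero_of_mul hi)
      obtain ⟨h3, h4⟩ := hQ _ (right_ne_zero_of_mul hi)
      rw [← List.take_append_drop i w]
      refine ⟨h1.append h3, ?_⟩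
      rw [wordVal_append, wordVal_append, h3.length_eq]
      exact add_le_add (Nat.mul_le_mul_right _ h2) h4
    have hlt : wordVal B (u ++ v) < wordVal B (v ++ u) :=
      (slope_lt_iff hB hu.1 hv.1).1 (((isLyndon_iff hB hlB).1 hl).2 u v hu.1 hv.1 rfl)
    refine ⟨⁅P, Q⁆, (freeLie K).lie_mem hP hQ, ?_, ?_⟩
    · have hQP : wordCoeff (Q * P) (u ++ v) = 0 := by
        by_contra hne
        exact absurd (hmul Q P v u hQw hPw _ hne).2 (not_le.2 hlt)
      rw [Ring.lie_def, wordCoeff_sub, hQP, sub_zero, wordCoeff_mul, convolution,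
        Finset.sum_eq_single_of_mem u.length (by simp)]
      · simp [hP1, hQ1]
      · intro i hi hne
        by_contra hc
        have := (hPw _ (left_ne_zero_of_mul hc)).1.length_eq
        simp at hi this
        omega
    · intro w hw
      rw [Ring.lie_def, wordCoeff_sub] at hw
      by_cases hPQ : wordCoeff (P * Q) w = 0
      · rw [hPQ, zero_sub, neg_ne_zero] at hw
        obtain ⟨h1, h2⟩ := hmul Q P v u hQw hPw _ hw
        exact ⟨h1.trans List.perm_append_comm, hlt.le.trans h2⟩
      · exact hmul P Q u v hPw hQw _ hPQ
  · obtain ⟨a, rfl⟩ : ∃ a, l = [a] := by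
      rw [← List.length_eq_one_iff]
      have := List.length_pos_iff.2 hl.1
      omega
    refine ⟨word K [a], LieSubalgebra.subset_lieSpan ⟨a, rfl⟩, by simp [wordCoeff_word], ?_⟩
    intro w hw
    rw [wordCoeff_word] at hw
    obtain rfl : [a] = w := by by_contra h; simp [h] at hw
    exact ⟨List.Perm.refl _, le_rfl⟩
termination_by l.length
decreasing_by all_goals (subst_vars; simp only [List.length_append]; omega)

/-- Lie elements of a given content can be found with prescribed coefficients at the Lyndon words;
these are prescribed one after the other, in increasing order. -/
lemma exists_mem_lieElements (n : ℕ →₀ ℕ) (β : List ℕ → K) :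
    ∃ P ∈ lieElements K n, ∀ w, HasContent w n → IsLyndon w → wordCoeff P w = β w := by
  obtain ⟨w₀, hw₀⟩ := exists_hasContent n
  obtain ⟨B, hB, hw₀B⟩ := exists_letter_bound w₀
  have hnB : ∀ {w}, HasContent w n → ∀ i ∈ w, i < B :=
    fun hw i hi => hw₀B i ((hw.perm hw₀).mem_iff.1 hi)
  suffices H : ∀ t : ℕ, ∃ P ∈ lieElements K n, ∀ w, HasContent w n → IsLyndon w →
      wordVal B w < t → wordCoeff P w = β w by
    obtain ⟨P, hP, h⟩ := H (B ^ w₀.length)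
    exact ⟨P, hP, fun w hw hl => h w hw hl
      ((hw.perm hw₀).length_eq ▸ wordVal_lt B w (hnB hw))⟩
  intro t
  induction t with
  | zero => exact ⟨0, ⟨(freeLie K).zero_mem, fun w hw => absurd rfl hw⟩, by simp⟩
  | succ t ih =>
    obtain ⟨P, ⟨hP, hPn⟩, hPβ⟩ := ih
    by_cases hl : ∃ l, HasContent l n ∧ IsLyndon l ∧ wordVal B l = t
    · obtain ⟨l, hln, hll, rfl⟩ := hl
      obtain ⟨Q, hQ, hQ1, hQw⟩ := exists_lyndon_bracket (K := K) hB l (hnB hln) hll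
      refine ⟨P + (β l - wordCoeff P l) • Q,
        ⟨(freeLie K).add_mem hP ((freeLie K).smul_mem _ hQ), fun w hw => ?_⟩, ?_⟩
      · by_cases h0 : wordCoeff P w = 0
        · rw [wordCoeff_add, h0, zero_add, wordCoeff_smul] at hw
          exact hln.of_perm (hQw w (right_ne_zero_of_mul hw)).1
        · exact hPn w h0
      · intro w hw hwl hlt
        rw [wordCoeff_add, wordCoeff_smul]
        rcases Nat.lt_succ_iff_lt_or_eq.1 hlt with hlt | heq
        · have : wordCoeff Q w = 0 := by
            by_contra hne
            exact absurd (hQw w hne).2 (not_le.2 hlt)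
          rw [this, mul_zero, add_zero, hPβ w hw hwl hlt]
        · obtain rfl : w = l :=
            wordVal_injective (hnB hw) (hnB hln) (hw.perm hln).length_eq heq
          rw [hQ1]; ring
    · refine ⟨P, ⟨hP, hPn⟩, fun w hw hwl hlt => ?_⟩
      rcases Nat.lt_succ_iff_lt_or_eq.1 hlt with hlt | heq
      · exact hPβ w hw hwl hlt
      · exact absurd ⟨w, hw, hwl, heq⟩ hl

/-- A polynomial of nonzero content `n` that vanishes on proper shuffles is determined by its
coefficients at the Lyndon words. -/
lemma eq_of_lyndon [CharZero K] {n : ℕ →₀ ℕ} (hn : n ≠ 0) {P Q : WordAlgebra K ℕ}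
    (hPn : ∀ w, wordCoeff P w ≠ 0 → HasContent w n) (hQn : ∀ w, wordCoeff Q w ≠ 0 → HasContent w n)
    (hP : ∀ u v, u ≠ [] → v ≠ [] → HasContent (u ++ v) n → shuffleSum (wordCoeff P) u v = 0)
    (hQ : ∀ u v, u ≠ [] → v ≠ [] → HasContent (u ++ v) n → shuffleSum (wordCoeff Q) u v = 0)
    (h : ∀ w, HasContent w n → IsLyndon w → wordCoeff P w = wordCoeff Q w) : P = Q := by
  refine wordAlgebra_ext fun w => ?_
  by_cases hw : HasContent w n
  · have hw0 : w ≠ [] := by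
      rintro rfl
      exact hn (Finsupp.ext fun i => (hw i).symm)
    refine sub_eq_zero.1 (eq_zero_of_lyndon (fun w => wordCoeff P w - wordCoeff Q w) w hw0 ?_ ?_)
    · intro u v hu hv huv
      have := shuffleSum_add (wordCoeff P) (fun x => (-1) * wordCoeff Q x) u v
      rw [shuffleSum_mul_left, hP u v hu hv (hw.of_perm huv), hQ u v hu hv (hw.of_perm huv)] at this
      simpa [sub_eq_add_neg] using this
    · intro l hlw hl
      rw [h l (hw.of_perm hlw) hl, sub_self]
  · rw [not_imp_comm.1 (hPn w) hw, not_imp_comm.1 (hQn w) hw]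

lemma existsUnique_lieElement [CharZero K] {n : ℕ →₀ ℕ} (hn : n ≠ 0) (β : List ℕ → K) :
    ∃! P, P ∈ lieElements K n ∧
      ∀ w : List ℕ, HasContent w n → IsLyndon w → wordCoeff P w = β w := by
  obtain ⟨P, hP, hPβ⟩ := exists_mem_lieElements n β
  refine ⟨P, ⟨hP, hPβ⟩, fun Q ⟨hQ, hQβ⟩ => ?_⟩
  exact eq_of_lyndon hn hQ.2 hP.2
    (fun u v hu hv _ => (shuffleSum_of_mem_freeLie hQ.1).2 u v hu hv)
    (fun u v hu hv _ => (shuffleSum_of_mem_freeLie hP.1).2 u v hu hv)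
    fun w hw hl => (hQβ w hw hl).trans (hPβ w hw hl).symm

/-- The other half of Ree's theorem: a polynomial whose coefficients vanish on proper shuffles
coincides with the Lie element that has the same coefficients at the Lyndon words. -/
lemma mem_lieElements_of_shuffleSum [CharZero K] {n : ℕ →₀ ℕ} (hn : n ≠ 0) {P : WordAlgebra K ℕ}
    (hPn : ∀ w, wordCoeff P w ≠ 0 → HasContent w n)
    (hP : ∀ u v, u ≠ [] → v ≠ [] → HasContent (u ++ v) n → shuffleSum (wordCoeff P) u v = 0) :
    P ∈ lieElements K n := by
  obtain ⟨Q, hQ, hQβ⟩ := exists_mem_lieElements n (wordCoeff P)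
  rw [eq_of_lyndon hn hPn hQ.2 hP
    (fun u v hu hv _ => (shuffleSum_of_mem_freeLie hQ.1).2 u v hu hv)
    fun w hw hl => (hQβ w hw hl).symm]
  exact hQ

end Lie

/-! ### The coefficients of the product formula -/

/-- The words in positive letters whose letters add up to `k`. -/
def wordsOfWeight (k : ℕ) : Finset (List ℕ) :=
  (Finset.univ : Finset (Composition k)).image Composition.blocks

lemma mem_wordsOfWeight {k : ℕ} {w : List ℕ} :
    w ∈ wordsOfWeight k ↔ (∀ i ∈ w, 0 < i) ∧ w.sum = k := by
  simp only [wordsOfWeight, Finset.mem_image, Finset.mem_univ, true_and]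
  constructor
  · rintro ⟨c, rfl⟩
    exact ⟨fun i hi => c.blocks_pos hi, c.blocks_sum⟩
  · rintro ⟨h1, h2⟩
    exact ⟨⟨w, fun hi => h1 _ hi, h2⟩, rfl⟩

lemma length_le_sum {w : List ℕ} (hw : ∀ i ∈ w, 0 < i) : w.length ≤ w.sum := by
  induction w with
  | nil => simp
  | cons a w ih =>
    have h1 := hw a List.mem_cons_self
    have h2 := ih fun i hi => hw i (List.mem_cons_of_mem _ hi)
    simp only [List.length_cons, List.sum_cons]
    omega

/-- Summing over the words of weight `k` together with a cut is the same as summing over pairs of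
words of total weight `k`. -/
lemma sum_wordsOfWeight_cut {M : Type*} [AddCommMonoid M] (h : List ℕ → List ℕ → M) (k : ℕ) :
    ∑ w ∈ wordsOfWeight k, ∑ i ∈ Finset.range (w.length + 1), h (w.take i) (w.drop i) =
      ∑ ab ∈ Finset.HasAntidiagonal.antidiagonal k,
        ∑ u ∈ wordsOfWeight ab.1, ∑ v ∈ wordsOfWeight ab.2, h u v := by
  simp_rw [← Finset.sum_product']
  rw [Finset.sum_sigma', Finset.sum_sigma']
  refine Finset.sum_bij' (fun x _ => ⟨((x.1.take x.2).sum, (x.1.drop x.2).sum),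
      (x.1.take x.2, x.1.drop x.2)⟩) (fun y _ => ⟨y.2.1 ++ y.2.2, y.2.1.length⟩) ?_ ?_ ?_ ?_ ?_
  · rintro ⟨w, i⟩ hx
    simp only [Finset.mem_sigma, mem_wordsOfWeight, Finset.HasAntidiagonal.mem_antidiagonal,
      Finset.mem_product] at hx ⊢
    refine ⟨?_, ⟨fun j hj => hx.1.1 j (List.mem_of_mem_take hj), trivial⟩,
      fun j hj => hx.1.1 j (List.mem_of_mem_drop hj), trivial⟩
    rw [List.sum_take_add_sum_drop, hx.1.2]
  · rintro ⟨⟨a, b⟩, u, v⟩ hy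
    simp only [Finset.mem_sigma, mem_wordsOfWeight, Finset.HasAntidiagonal.mem_antidiagonal,
      Finset.mem_product, Finset.mem_range, List.length_append, List.mem_append,
      List.sum_append] at hy ⊢
    obtain ⟨rfl, ⟨hu, rfl⟩, hv, rfl⟩ := hy
    exact ⟨⟨fun j hj => hj.elim (hu j) (hv j), rfl⟩, by omega⟩
  · rintro ⟨w, i⟩ hx
    simp only [Finset.mem_sigma, Finset.mem_range] at hx
    have : (w.take i).length = i := by simp; omega
    simp [List.take_append_drop, Nat.lt_succ_iff.1 hx.2]
  · rintro ⟨⟨a, b⟩, u, v⟩ hy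
    simp only [Finset.mem_sigma, mem_wordsOfWeight, Finset.HasAntidiagonal.mem_antidiagonal,
      Finset.mem_product] at hy
    obtain ⟨rfl, ⟨hu, rfl⟩, hv, rfl⟩ := hy
    simp
  · rintro ⟨w, i⟩ _
    rfl

section Evaluation

variable {K A : Type*} [Field K] [Ring A] [Algebra K A]

/-- The power series obtained from the noncommutative series with coefficients `f` by substituting
`x ^ i R i` for the letter `i`. -/
def wordSeries (R : ℕ → A) (f : List ℕ → K) : A⟦X⟧ :=
  PowerSeries.mk fun k => ∑ w ∈ wordsOfWeight k, f w • (w.map R).prod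

lemma wordSeries_mul (R : ℕ → A) (f g : List ℕ → K) :
    wordSeries R f * wordSeries R g = wordSeries R (convolution f g) := by
  ext k
  rw [PowerSeries.coeff_mul]
  simp only [wordSeries, PowerSeries.coeff_mk, convolution, Finset.sum_smul]
  have := sum_wordsOfWeight_cut (fun u v => (f u * g v) • ((u ++ v).map R).prod) k
  simp only [List.take_append_drop] at this
  rw [this]
  refine Finset.sum_congr rfl fun ab _ => ?_
  rw [Finset.sum_mul_sum]
  refine Finset.sum_congr rfl fun u _ => Finset.sum_congr rfl fun v _ => ?_
  rw [List.map_append, List.prod_append, smul_mul_smul_comm]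

lemma wordSeries_unitCoeff (R : ℕ → A) : wordSeries R (unitCoeff : List ℕ → K) = 1 := by
  ext k
  rw [wordSeries, PowerSeries.coeff_mk, PowerSeries.coeff_one]
  split_ifs with hk
  · rw [Finset.sum_eq_single_of_mem [] (mem_wordsOfWeight.2 ⟨by simp, by simp [hk]⟩)]
    · simp [unitCoeff]
    · intro w _ hw
      simp [unitCoeff, hw]
  · refine Finset.sum_eq_zero fun w hw => ?_
    have hw0 : w ≠ [] := by
      rintro rfl
      exact hk (by simpa using (mem_wordsOfWeight.1 hw).2.symm)
    simp [unitCoeff, hw0]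

/-- The part of word length `k` of the geometric series in `∑ i, a i • (letter i)`. -/
def lengthCoeff (a : ℕ → K) (k : ℕ) (w : List ℕ) : K := if w.length = k then (w.map a).prod else 0

lemma convolution_lengthCoeff (a : ℕ → K) (k : ℕ) :
    convolution (lengthCoeff a 1) (lengthCoeff a k) = lengthCoeff a (k + 1) := by
  funext w
  match w with
  | [] => simp [lengthCoeff]
  | b :: w =>
    rw [convolution_cons, convolution, Finset.sum_eq_single 0]
    · simp [lengthCoeff]
    · intro i hi hi0
      have : (w.take i).length ≠ 0 := by
        have := Finset.mem_range.1 hi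
        rw [List.length_take]
        omega
      rw [lengthCoeff, if_neg (by simpa using this), zero_mul]
    · simp

lemma wordSeries_lengthCoeff_one (R : ℕ → A) (a : ℕ → K) :
    wordSeries R (lengthCoeff a 1) = PowerSeries.mk fun n => if n = 0 then 0 else a n • R n := by
  ext n
  have hone : ∀ w ∈ wordsOfWeight n, w ≠ [n] → lengthCoeff a 1 w • (w.map R).prod = 0 := by
    intro w hw hne
    rw [lengthCoeff, if_neg, zero_smul]
    intro h1
    obtain ⟨b, rfl⟩ := List.length_eq_one_iff.1 h1
    have := (mem_wordsOfWeight.1 hw).2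
    rw [List.sum_singleton] at this
    exact hne (by rw [this])
  rw [wordSeries, PowerSeries.coeff_mk, PowerSeries.coeff_mk]
  split_ifs with hn
  · refine Finset.sum_eq_zero fun w hw => hone w hw ?_
    rintro rfl
    have := (mem_wordsOfWeight.1 hw).1 n (by simp)
    omega
  · rw [Finset.sum_eq_single_of_mem [n]
      (mem_wordsOfWeight.2 ⟨by simpa using Nat.pos_of_ne_zero hn, by simp⟩) hone]
    simp [lengthCoeff]

lemma wordSeries_lengthCoeff (R : ℕ → A) (a : ℕ → K) (k : ℕ) :
    (PowerSeries.mk fun n => if n = 0 then 0 else a n • R n) ^ k =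
      wordSeries R (lengthCoeff a k) := by
  induction k with
  | zero =>
    rw [pow_zero, ← wordSeries_unitCoeff (K := K) R]
    congr 1
    funext w
    cases w <;> simp [unitCoeff, lengthCoeff]
  | succ k ih =>
    rw [pow_succ', ih, ← wordSeries_lengthCoeff_one, wordSeries_mul, convolution_lengthCoeff]

lemma factor_eq_wordSeries (R : ℕ → A) (a : ℕ → K) :
    factor K (fun n => a n • R n) = wordSeries R (expCoeff a) := by
  ext n
  rw [factor, expSeries, PowerSeries.coeff_mk]
  simp only [wordSeries_lengthCoeff]
  simp only [wordSeries, PowerSeries.coeff_mk, Finset.smul_sum]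
  rw [Finset.sum_comm]
  refine Finset.sum_congr rfl fun w hw => ?_
  obtain ⟨h1, h2⟩ := mem_wordsOfWeight.1 hw
  have h3 := length_le_sum h1
  rw [Finset.sum_eq_single_of_mem w.length (by simp; omega)]
  · simp [lengthCoeff, expCoeff, mul_smul]
  · intro k _ hk
    simp [lengthCoeff, hk.symm]

lemma rescale_wordSeries (q : K) (R : ℕ → A) (f : List ℕ → K) :
    rescale q (wordSeries R f) = wordSeries R fun w => q ^ w.sum * f w := by
  ext n
  simp only [rescale, wordSeries, PowerSeries.coeff_mk, Finset.smul_sum]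
  refine Finset.sum_congr rfl fun w hw => ?_
  rw [(mem_wordsOfWeight.1 hw).2, mul_smul]

lemma pow_sum_mul_expCoeff (q : K) (a : ℕ → K) (w : List ℕ) :
    q ^ w.sum * expCoeff a w = expCoeff (fun i => q ^ i * a i) w := by
  rw [expCoeff, expCoeff, mul_left_comm]
  congr 1
  induction w with
  | nil => simp
  | cons b w ih =>
    simp only [List.map_cons, List.prod_cons, List.sum_cons, pow_add, ← ih]
    ring

/-- The convolution of the exponentials that belong to a list of factors `Q⁽ʲ⁾ (p_j x)`: the
coefficients of the product formula as a noncommutative series. -/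
def productCoeff {ι : Type*} (p : ι → K) (c : ι → ℕ → K) (L : List ι) : List ℕ → K :=
  (L.map fun j => expCoeff fun i => p j ^ i * c j i).foldr convolution unitCoeff

@[simp] lemma productCoeff_nil {ι : Type*} (p : ι → K) (c : ι → ℕ → K) :
    productCoeff p c [] = unitCoeff := rfl

@[simp] lemma productCoeff_cons {ι : Type*} (p : ι → K) (c : ι → ℕ → K) (j : ι) (L : List ι) :
    productCoeff p c (j :: L) =
      convolution (expCoeff fun i => p j ^ i * c j i) (productCoeff p c L) := rfl

lemma isShuffleCharacter_productCoeff [CharZero K] {ι : Type*} (p : ι → K) (c : ι → ℕ → K)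
    (L : List ι) : IsShuffleCharacter (productCoeff p c L) := by
  induction L with
  | nil => exact isShuffleCharacter_unitCoeff
  | cons j L ih => exact (isShuffleCharacter_expCoeff _).convolution ih

lemma productFormula_eq_wordSeries {r : ℕ} (p : Fin r → K) (c : Fin r → ℕ → K) (R : ℕ → A) :
    productFormula p c R = wordSeries R (productCoeff p c (List.finRange r)) := by
  rw [productFormula, List.ofFn_eq_map]
  generalize List.finRange r = L
  induction L with
  | nil => exact (wordSeries_unitCoeff R).symm
  | cons j L ih =>
    rw [List.map_cons, List.prod_cons, ih, productCoeff_cons, ← wordSeries_mul,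
      factor_eq_wordSeries, rescale_wordSeries]
    simp only [pow_sum_mul_expCoeff]

lemma expSeries_monomial_eq_wordSeries (R : ℕ → A) :
    expSeries K (PowerSeries.monomial 1 (R 1)) =
      wordSeries R (expCoeff fun i => if i = 1 then (1 : K) else 0) := by
  rw [← factor_eq_wordSeries, factor]
  congr 1
  ext n
  rw [PowerSeries.coeff_monomial, PowerSeries.coeff_mk]
  by_cases h1 : n = 1 <;> simp [h1]

/-- The monomials in free operators are linearly independent, weight by weight. -/
lemma sum_wordsOfWeight_eq_zero_iff {Λ : Set ℕ} {m : ℕ} {R : ℕ → A} (hR0 : ∀ n, n ∉ Λ → R n = 0)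
    (hR : IsFreeFamily K {i | i ∈ Λ ∧ i ≤ m} R) {k : ℕ} (hk : k ≤ m) (d : List ℕ → K) :
    ∑ w ∈ wordsOfWeight k, d w • (w.map R).prod = 0 ↔
      ∀ w ∈ wordsOfWeight k, (∀ i ∈ w, i ∈ Λ) → d w = 0 := by
  classical
  have hz : ∀ w : List ℕ, ¬ (∀ i ∈ w, i ∈ Λ) → (w.map R).prod = 0 := by
    intro w hw
    push Not at hw
    obtain ⟨i, hi, hiΛ⟩ := hw
    obtain ⟨s, t, rfl⟩ := List.append_of_mem hi
    simp [hR0 i hiΛ]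
  have hle : ∀ w ∈ wordsOfWeight k, ∀ i ∈ w, i ≤ m := fun w hw i hi =>
    (List.single_le_sum (by simp) i hi).trans ((mem_wordsOfWeight.1 hw).2.trans_le hk)
  constructor
  · intro h w hw hwΛ
    rw [← Finset.sum_filter_of_ne (p := fun w => ∀ i ∈ w, i ∈ {i | i ∈ Λ ∧ i ≤ m}),
      ← Finset.sum_subtype_eq_sum_filter] at h
    · exact linearIndependent_iff'.1 hR _ (fun w => d w.1) h
        ⟨w, fun i hi => ⟨hwΛ i hi, hle w hw i hi⟩⟩ (by simpa using hw)
    · intro w hw hne i hi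
      refine ⟨?_, hle w hw i hi⟩
      by_contra hiΛ
      exact hne (by rw [hz w fun h => hiΛ (h i hi), smul_zero])
  · intro h
    refine Finset.sum_eq_zero fun w hw => ?_
    by_cases hwΛ : ∀ i ∈ w, i ∈ Λ
    · rw [h w hw hwΛ, zero_smul]
    · rw [hz w hwΛ, smul_zero]

/-- `exp` of the first letter and the product formula have the same coefficients at the powers of
the first letter. -/
lemma productCoeff_replicate [CharZero K] {ι : Type*} {p : ι → K} {c : ι → ℕ → K} {L : List ι}
    (hp : (L.map p).sum = 1) (hc : ∀ j, c j 1 = 1) (k : ℕ) :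
    productCoeff p c L (List.replicate k 1) = (k.factorial : K)⁻¹ := by
  have hG := isShuffleCharacter_productCoeff p c L
  have h1 : ∀ L : List ι, productCoeff p c L [1] = (L.map p).sum := by
    intro L
    induction L with
    | nil => rfl
    | cons j L ih =>
      rw [productCoeff_cons, convolution_cons, convolution_nil, ih,
        (isShuffleCharacter_productCoeff p c L).1]
      simp [expCoeff, hc, add_comm]
  induction k with
  | zero => simp [hG.1]
  | succ k ih =>
    have hs := hG.2 [1] (List.replicate k 1)
    have hconst : (shuffles [1] (List.replicate k 1)).map (productCoeff p c L) =
        (shuffles [1] (List.replicate k 1)).map fun _ =>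
          productCoeff p c L (List.replicate (k + 1) 1) :=
      List.map_congr_left fun z hz => by
        have hz' : z.Perm (List.replicate (k + 1) 1) := perm_of_mem_shuffles _ _ _ hz
        rw [List.perm_replicate.1 hz']
    rw [shuffleSum, hconst, List.map_const', List.sum_replicate, length_shuffles, h1, hp, ih,
      one_mul, List.length_singleton, List.length_replicate, Nat.choose_one_right,
      nsmul_eq_mul] at hs
    have hk : ((1 + k : ℕ) : K) ≠ 0 := by exact_mod_cast (by omega : 1 + k ≠ 0)
    rw [Nat.factorial_succ, Nat.cast_mul, mul_inv, ← hs, add_comm k 1, inv_mul_cancel_left₀ hk]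

/-- The approximation property is the vanishing of the coefficients of all words, up to the given
weight, that are not powers of the first letter. -/
lemma isApproximant_iff [CharZero K] {Λ : Set ℕ} (hΛ0 : 0 ∉ Λ) {m : ℕ} {R : ℕ → A}
    (hR0 : ∀ n, n ∉ Λ → R n = 0) (hR : IsFreeFamily K {i | i ∈ Λ ∧ i ≤ m} R)
    {r : ℕ} {p : Fin r → K} (hp : ∑ j, p j = 1) {c : Fin r → ℕ → K} (hc : ∀ j, c j 1 = 1)
    {k : ℕ} (hk : k ≤ m) :
    IsApproximant K k (R 1) (productFormula p c R) ↔
      ∀ w : List ℕ, (∀ i ∈ w, i ∈ Λ) → w.sum ≤ k → (∃ i ∈ w, i ≠ 1) →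
        productCoeff p c (List.finRange r) w = 0 := by
  have key : IsApproximant K k (R 1) (productFormula p c R) ↔
      ∀ l ≤ k, ∀ w ∈ wordsOfWeight l, (∀ i ∈ w, i ∈ Λ) →
        productCoeff p c (List.finRange r) w - expCoeff (fun i => if i = 1 then 1 else 0) w =
          0 := by
    refine forall₂_congr fun l hl => ?_
    rw [← sum_wordsOfWeight_eq_zero_iff hR0 hR (hl.trans hk), productFormula_eq_wordSeries,
      expSeries_monomial_eq_wordSeries]
    simp only [wordSeries, PowerSeries.coeff_mk, sub_smul, Finset.sum_sub_distrib, sub_eq_zero]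
  have hexp : ∀ w : List ℕ, (∃ i ∈ w, i ≠ 1) →
      expCoeff (fun i => if i = 1 then (1 : K) else 0) w = 0 := by
    rintro w ⟨i, hi, hi1⟩
    rw [expCoeff, List.prod_eq_zero, mul_zero]
    exact List.mem_map.2 ⟨i, hi, by simp [hi1]⟩
  rw [key]
  constructor
  · intro h w hwΛ hwk hw
    have := h _ hwk w (mem_wordsOfWeight.2
      ⟨fun i hi => Nat.pos_of_ne_zero fun h0 => hΛ0 (h0 ▸ hwΛ i hi), rfl⟩) hwΛ
    rwa [hexp w hw, sub_zero] at this
  · intro h l hl w hw hwΛ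
    by_cases hw1 : ∃ i ∈ w, i ≠ 1
    · rw [h w hwΛ ((mem_wordsOfWeight.1 hw).2.trans_le hl) hw1, hexp w hw1, sub_zero]
    · push Not at hw1
      have hw' : w = List.replicate w.length 1 := List.eq_replicate_iff.2 ⟨rfl, hw1⟩
      rw [hw', productCoeff_replicate (by rw [← hp, ← List.ofFn_eq_map, List.sum_ofFn]) hc]
      simp [expCoeff]

end Evaluation

/-! ### Sums over the rearrangements of a word -/

section Rearrangements

variable {T M : Type*} [AddCommMonoid M]

lemma list_sum_comm {α β : Type*} (l : List α) (l' : List β) (f : α → β → M) :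
    (l.map fun x => (l'.map fun y => f x y).sum).sum =
      (l'.map fun y => (l.map fun x => f x y).sum).sum := by
  induction l with
  | nil => simp
  | cons a l ih => simp [ih, List.sum_map_add]

/-- The sum over all rearrangements of a word, with multiplicities. -/
def permSum (F : List T → M) (s : List T) : M := (s.permutations'.map F).sum

/-- The sum over all insertions of a letter into a word. -/
def insertSum (a : T) (F : List T → M) (w : List T) : M := ((w.permutations'Aux a).map F).sum

/-- The sum over all cuts of a word into two words. -/
def cutSum (H : List T → List T → M) (w : List T) : M :=
  ∑ i ∈ Finset.range (w.length + 1), H (w.take i) (w.drop i)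

/-- The sum over all ways to split a word into two complementary subwords. -/
def splitSum : List T → (List T → List T → M) → M
  | [], H => H [] []
  | i :: s, H => splitSum s (fun x y => H (i :: x) y) + splitSum s (fun x y => H x (i :: y))

@[simp] lemma permSum_nil (F : List T → M) : permSum F [] = F [] := by simp [permSum]

lemma permSum_cons (F : List T → M) (a : T) (s : List T) :
    permSum F (a :: s) = permSum (insertSum a F) s := by
  simp only [permSum, List.permutations', List.flatMap_def, List.map_flatten, List.sum_flatten,
    List.map_map]
  rfl

lemma permSum_add (F G : List T → M) (s : List T) :
    permSum (fun x => F x + G x) s = permSum F s + permSum G s := by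
  simp [permSum, List.sum_map_add]

lemma permSum_congr {F G : List T → M} {s : List T} (h : ∀ w, w.Perm s → F w = G w) :
    permSum F s = permSum G s := by
  rw [permSum, permSum, List.map_congr_left fun w hw => h w (List.mem_permutations'.1 hw)]

@[simp] lemma insertSum_nil (a : T) (F : List T → M) : insertSum a F [] = F [a] := by
  simp [insertSum]

lemma insertSum_cons (a b : T) (F : List T → M) (w : List T) :
    insertSum a F (b :: w) = F (a :: b :: w) + insertSum a (fun z => F (b :: z)) w := by
  simp [insertSum, Function.comp_def]

lemma insertSum_add (a : T) (F G : List T → M) (w : List T) :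
    insertSum a (fun x => F x + G x) w = insertSum a F w + insertSum a G w := by
  simp [insertSum, List.sum_map_add]

@[simp] lemma cutSum_nil (H : List T → List T → M) : cutSum H [] = H [] [] := by simp [cutSum]

lemma cutSum_cons (H : List T → List T → M) (a : T) (w : List T) :
    cutSum H (a :: w) = H [] (a :: w) + cutSum (fun x y => H (a :: x) y) w := by
  rw [cutSum, List.length_cons, Finset.sum_range_succ', add_comm]
  rfl

lemma cutSum_add (H H' : List T → List T → M) (w : List T) :
    cutSum (fun x y => H x y + H' x y) w = cutSum H w + cutSum H' w :=
  Finset.sum_add_distrib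

lemma splitSum_add (s : List T) (H H' : List T → List T → M) :
    splitSum s (fun x y => H x y + H' x y) = splitSum s H + splitSum s H' := by
  induction s generalizing H H' with
  | nil => rfl
  | cons i s ih => simp only [splitSum, ih]; abel

lemma splitSum_zero (s : List T) : splitSum s (fun _ _ => (0 : M)) = 0 := by
  induction s with
  | nil => rfl
  | cons i s ih => simp [splitSum, ih]

lemma splitSum_smul {R : Type*} [Semiring R] [Module R M] (k : R) (s : List T)
    (H : List T → List T → M) : splitSum s (fun x y => k • H x y) = k • splitSum s H := by
  induction s generalizing H with
  | nil => rfl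
  | cons i s ih => simp only [splitSum, ih, smul_add]

lemma splitSum_list_sum {ι : Type*} (L : List ι) (s : List T) (H : ι → List T → List T → M) :
    splitSum s (fun x y => (L.map fun j => H j x y).sum) =
      (L.map fun j => splitSum s (H j)).sum := by
  induction L with
  | nil => exact splitSum_zero s
  | cons j L ih => simp only [List.map_cons, List.sum_cons, splitSum_add, ih]

/-- A letter inserted into a word that is then cut is inserted into one of the two parts. -/
lemma insertSum_cutSum (a : T) (H : List T → List T → M) (w : List T) :
    insertSum a (cutSum H) w = cutSum (fun x y => insertSum a (fun z => H z y) x) w +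
      cutSum (fun x y => insertSum a (fun z => H x z) y) w := by
  induction w generalizing H with
  | nil => simp [cutSum_cons, add_comm]
  | cons b w ih =>
    simp only [insertSum_cons, cutSum_cons, insertSum_add, ih, insertSum_nil, cutSum_add]
    abel

/-- Rearranging a word and cutting the result is the same as splitting the word into two subwords
and rearranging both of them. -/
lemma permSum_cutSum (H : List T → List T → M) (s : List T) :
    permSum (cutSum H) s = splitSum s fun x y => permSum (fun u => permSum (H u) y) x := by
  induction s generalizing H with
  | nil => simp [splitSum]
  | cons a s ih =>
    rw [permSum_cons, splitSum, funext (insertSum_cutSum a H), permSum_add, ih, ih]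
    simp only [permSum_cons]
    congr 2
    funext x y
    simp only [permSum, insertSum, list_sum_comm y.permutations']
    rfl

lemma symmetrize_eq_permSum {K : Type*} [Field K] (x : List T) :
    symmetrize K x = ((x.length.factorial : K)⁻¹) • permSum (word K) x := by
  rw [symmetrize, permSum, ((List.permutations_perm_permutations' x).map _).sum_eq]

end Rearrangements

/-! ### The number of rearrangements that give a fixed word -/

section Counting

/-- The words obtained from a word by deleting one occurrence of the letter `a`. -/
def deletions (a : ℕ) : List ℕ → List (List ℕ)
  | [] => []
  | b :: w => (if b = a then [w] else []) ++ (deletions a w).map (List.cons b)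

lemma length_deletions (a : ℕ) (w : List ℕ) : (deletions a w).length = w.count a := by
  induction w with
  | nil => rfl
  | cons b w ih =>
    by_cases h : b = a <;> simp [deletions, h, ih]

lemma perm_of_mem_deletions {a : ℕ} {w y : List ℕ} (h : y ∈ deletions a w) :
    (a :: y).Perm w := by
  induction w generalizing y with
  | nil => simp [deletions] at h
  | cons b w ih =>
    rw [deletions, List.mem_append, List.mem_map] at h
    rcases h with h | ⟨z, hz, rfl⟩
    · split_ifs at h with hb
      · simp at h; rw [h, hb]
      · simp at h
    · exact (List.Perm.swap b a z).trans ((ih hz).cons b)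

lemma count_map_cons (b d : ℕ) (w : List ℕ) (l : List (List ℕ)) :
    (l.map (List.cons d)).count (b :: w) = if d = b then l.count w else 0 := by
  split_ifs with h
  · subst h
    exact List.count_map_of_injective _ _ List.cons_injective _
  · rw [List.count_eq_zero]
    simp [h]

/-- Deletion of a letter is adjoint to its insertion. -/
lemma count_permutations'Aux (a : ℕ) (x w : List ℕ) :
    (x.permutations'Aux a).count w = (deletions a w).count x := by
  have hnil : ∀ (d : ℕ) (l : List (List ℕ)), (l.map (List.cons d)).count [] = 0 := by
    intro d l
    rw [List.count_eq_zero]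
    simp
  have hhead : ∀ (c b : ℕ) (x w : List ℕ),
      (if b = c then [w] else []).count x = if b = c ∧ w = x then 1 else 0 := by
    intro c b x w
    by_cases h : b = c <;> simp [h, List.count_singleton]
  induction x generalizing w with
  | nil =>
    match w with
    | [] => simp [deletions]
    | b :: w =>
      rw [deletions, List.count_append, hnil, hhead, List.permutations'Aux, List.count_singleton]
      simp only [beq_iff_eq, List.cons.injEq, add_zero, @eq_comm _ a b, @eq_comm _ [] w]
  | cons b x ih =>
    match w with
    | [] => simp [deletions, hnil, List.permutations'Aux]
    | d :: w =>
      rw [List.permutations'Aux, List.count_cons, count_map_cons, ih, deletions, List.count_append,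
        count_map_cons, hhead]
      simp only [beq_iff_eq, List.cons.injEq, @eq_comm _ a d, @eq_comm _ (b :: x) w,
        @eq_comm _ b d]
      exact add_comm _ _

lemma sum_map_count_comm (l l' : List (List ℕ)) :
    (l.map fun x => l'.count x).sum = (l'.map fun y => l.count y).sum := by
  have h : ∀ (l : List (List ℕ)) x, l.count x = (l.map fun y => if y = x then 1 else 0).sum := by
    intro l x
    induction l with
    | nil => rfl
    | cons y l ih => simp [List.count_cons, ih, add_comm]
  simp only [h]
  rw [list_sum_comm]
  simp only [eq_comm]

/-- A word of content `n` arises from `∏ i, (n i)!` of the permutations of any word with the same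
content. -/
lemma count_permutations' {n : ℕ →₀ ℕ} {s w : List ℕ} (hs : HasContent s n) (hw : w.Perm s) :
    s.permutations'.count w = n.prod fun _ k => k.factorial := by
  induction s generalizing n w with
  | nil =>
    have : n = 0 := Finsupp.ext fun i => (hs i).symm
    rw [List.perm_nil.1 hw, this]
    simp
  | cons a s ih =>
    have hn' := hasContent_toFinsupp s
    set n' := Multiset.toFinsupp (s : Multiset ℕ)
    have hne : ∀ i, i ≠ a → n i = n' i := fun i hi => by
      rw [← hs i, ← hn' i, List.count_cons_of_ne hi.symm]
    have ha : n a = n' a + 1 := by rw [← hs a, ← hn' a, List.count_cons_self]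
    have hsub : n'.support ⊆ n.support := by
      intro i hi
      rw [Finsupp.mem_support_iff] at hi ⊢
      rcases eq_or_ne i a with rfl | h
      · omega
      · rwa [hne i h]
    have hmem : a ∈ n.support := by rw [Finsupp.mem_support_iff]; omega
    have hprod : (n.prod fun _ k => k.factorial) = w.count a * n'.prod fun _ k => k.factorial := by
      rw [n'.prod_of_support_subset hsub _ (by simp), Finsupp.prod,
        ← Finset.mul_prod_erase _ _ hmem,
        ← Finset.mul_prod_erase n.support (fun i => (n' i).factorial) hmem, hw.count_eq, hs a, ha,
        Nat.factorial_succ, mul_assoc]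
      congr 2
      exact Finset.prod_congr rfl fun i hi => by rw [hne i (Finset.ne_of_mem_erase hi)]
    rw [List.permutations', List.count_flatMap, Function.comp_def]
    simp only [count_permutations'Aux]
    rw [sum_map_count_comm, hprod, ← length_deletions,
      List.map_congr_left (g := fun _ => n'.prod fun _ k => k.factorial) fun y hy =>
        ih hn' ((List.perm_cons a).1 ((perm_of_mem_deletions hy).trans hw)),
      List.map_const', List.sum_replicate, smul_eq_mul]

end Counting

/-! ### The coefficients of the time-ordered symmetrized products -/

section TimeOrdered

variable {K : Type*} [Field K]

/-- The operation `PS` as a linear map. -/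
def PSLinear (K : Type*) [Field K] (r : ℕ) :
    WordAlgebra K (Fin r × ℕ) →ₗ[K] WordAlgebra K (Fin r × ℕ) :=
  (Finsupp.linearCombination K fun w => timeOrderWord K (FreeMonoid.toList w)) ∘ₗ
    (MonoidAlgebra.coeffLinearEquiv K).toLinearMap

lemma PSLinear_apply {r : ℕ} (P : WordAlgebra K (Fin r × ℕ)) : PSLinear K r P = PS K P := rfl

lemma PS_word {r : ℕ} (w : List (Fin r × ℕ)) : PS K (word K w) = timeOrderWord K w := by
  rw [PS, word, MonoidAlgebra.coeff_single, Finsupp.sum_single_index (by simp), one_smul]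
  rfl

/-- The sum over all assignments of colours from `L` to the letters of a word, where colour `j`
has weight `p j ^ i` at the letter `i`. -/
def colorSum {ι M : Type*} [AddCommMonoid M] [Module K M] (p : ι → K) (L : List ι) :
    List ℕ → (List (ι × ℕ) → M) → M
  | [], F => F []
  | i :: s, F => (L.map fun j => p j ^ i • colorSum p L s fun ω => F ((j, i) :: ω)).sum

/-- Expansion of a product of the `Y_i`. -/
lemma map_prod_Y {M : Type*} [AddCommMonoid M] [Module K M] {r : ℕ} (p : Fin r → K)
    (s : List ℕ) (Φ : WordAlgebra K (Fin r × ℕ) →ₗ[K] M) :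
    Φ (s.map (Y p)).prod = colorSum p (List.finRange r) s fun ω => Φ (word K ω) := by
  induction s generalizing Φ with
  | nil => rfl
  | cons i s ih =>
    rw [List.map_cons, List.prod_cons, Y, Finset.sum_mul, map_sum, colorSum, ← List.ofFn_eq_map,
      List.sum_ofFn]
    refine Finset.sum_congr rfl fun j _ => ?_
    rw [smul_mul_assoc, map_smul]
    congr 1
    refine (ih (Φ ∘ₗ LinearMap.mulLeft K (word K [(j, i)]))).trans ?_
    simp only [LinearMap.comp_apply, LinearMap.mulLeft_apply, ← word_append, List.singleton_append]

/-- The effect of symmetrization and of the substitution `R_{jn} = c_{jn} R_n` on a word. -/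
def colorBlock {ι : Type*} (c : ι → ℕ → K) (ω : List (ι × ℕ)) : WordAlgebra K ℕ :=
  (ω.map fun l => c l.1 l.2).prod • symmetrize K (ω.map Prod.snd)

/-- The product over the colours in `L` of the symmetrized subwords of the letters of this
colour. -/
def orderedProd {ι : Type*} [DecidableEq ι] (c : ι → ℕ → K) (L : List ι) (ω : List (ι × ℕ)) :
    WordAlgebra K ℕ :=
  (L.map fun j => colorBlock c (ω.filter fun l => l.1 = j)).prod

lemma substitute_word {r : ℕ} (c : Fin r → ℕ → K) (w : List (Fin r × ℕ)) :
    substitute c (word K w) = (w.map fun l => c l.1 l.2).prod • word K (w.map Prod.snd) := by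
  rw [substitute, word, MonoidAlgebra.lift_single, one_smul]
  induction w with
  | nil => simp [word, MonoidAlgebra.one_def]
  | cons l w ih =>
    rw [FreeMonoid.ofList_cons, map_mul, ih, FreeMonoid.lift_eval_of, smul_mul_smul_comm,
      ← word_append]
    simp

lemma substitute_symmetrize {r : ℕ} (c : Fin r → ℕ → K) (w : List (Fin r × ℕ)) :
    substitute c (symmetrize K w) = colorBlock c w := by
  rw [symmetrize, colorBlock, symmetrize, map_smul, map_list_sum, List.map_map, List.length_map,
    smul_comm, ← List.map_permutations, List.map_map]
  congr 1
  rw [List.smul_sum, List.map_map]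
  congr 1
  refine List.map_congr_left fun x hx => ?_
  simp only [Function.comp_apply, substitute_word]
  rw [((List.perm_of_mem_permutations hx).map _).prod_eq]

lemma substitute_timeOrderWord {r : ℕ} (c : Fin r → ℕ → K) (w : List (Fin r × ℕ)) :
    substitute c (timeOrderWord K w) = orderedProd c (List.finRange r) w := by
  rw [timeOrderWord, map_list_prod, List.map_ofFn, List.ofFn_eq_map, orderedProd]
  simp only [Function.comp_def, substitute_symmetrize]

/-- If the summand factors into a part that depends on the letters of the first colour and a part
that depends on the other letters, the sum over all assignments of colours becomes a sum over
all splittings into two subwords. -/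
lemma colorSum_cons {ι : Type*} [DecidableEq ι] (p : ι → K) (j₀ : ι) (L : List ι) (hj₀ : j₀ ∉ L)
    (s : List ℕ) (α β : List (ι × ℕ) → WordAlgebra K ℕ) :
    colorSum p (j₀ :: L) s (fun ω => α (ω.filter fun l => l.1 = j₀) *
      β (ω.filter fun l => l.1 ≠ j₀)) =
    splitSum s fun x y => ((x.map fun i => p j₀ ^ i).prod • α (x.map fun i => (j₀, i))) *
      colorSum p L y β := by
  induction s generalizing α β with
  | nil => simp [colorSum, splitSum]
  | cons i s ih =>
    rw [colorSum, splitSum, List.map_cons, List.sum_cons]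
    congr 1
    · have := ih (fun ω => α ((j₀, i) :: ω)) β
      simp only [List.filter_cons, decide_true, ne_eq, not_true_eq_false, decide_false, if_true,
        Bool.false_eq_true, if_false, List.map_cons, List.prod_cons] at this ⊢
      rw [this, ← splitSum_smul]
      simp only [smul_mul_assoc, mul_smul]
    · simp only [colorSum, ← List.sum_map_mul_left, splitSum_list_sum]
      congr 1
      refine List.map_congr_left fun j hj => ?_
      have hne : j ≠ j₀ := fun h => hj₀ (h ▸ hj)
      have := ih α (fun ω => β ((j, i) :: ω))
      simp only [List.filter_cons, ne_eq, hne, not_false_eq_true, decide_true, decide_false,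
        if_true, Bool.false_eq_true, if_false] at this ⊢
      rw [this, ← splitSum_smul]
      simp only [mul_smul_comm]

/-- The sum over all assignments of colours of the time-ordered symmetrized words is a sum over
all rearrangements, weighted by the coefficients of the product formula. -/
lemma colorSum_orderedProd {ι : Type*} [DecidableEq ι] (p : ι → K) (c : ι → ℕ → K) (L : List ι)
    (hL : L.Nodup) (s : List ℕ) :
    colorSum p L s (orderedProd c L) = permSum (fun w => productCoeff p c L w • word K w) s := by
  induction L generalizing s with
  | nil =>
    match s with
    | [] => simp [colorSum, orderedProd, unitCoeff, word, MonoidAlgebra.one_def]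
    | i :: s =>
      rw [colorSum, permSum_congr (G := fun _ => 0)]
      · simp [permSum]
      · intro w hw
        have : w ≠ [] := by rintro rfl; simpa using hw.length_eq
        simp [unitCoeff, this]
  | cons j₀ L ih =>
    obtain ⟨hj₀, hL'⟩ := List.nodup_cons.1 hL
    have hfac : orderedProd c (j₀ :: L) = fun ω => colorBlock c (ω.filter fun l => l.1 = j₀) *
        orderedProd c L (ω.filter fun l => l.1 ≠ j₀) := by
      funext ω
      rw [orderedProd, List.map_cons, List.prod_cons, orderedProd]
      congr 2
      refine List.map_congr_left fun j hj => ?_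
      have hne : j ≠ j₀ := fun h => hj₀ (h ▸ hj)
      rw [List.filter_filter]
      congr 1
      refine List.filter_congr fun l _ => ?_
      by_cases h : l.1 = j
      · simp [h, hne]
      · simp [h]
    have hcut : (fun w => productCoeff p c (j₀ :: L) w • word K w) = cutSum fun u v =>
        (expCoeff (fun i => p j₀ ^ i * c j₀ i) u • word K u) *
          (productCoeff p c L v • word K v) := by
      funext w
      rw [productCoeff_cons, convolution, cutSum, Finset.sum_smul]
      refine Finset.sum_congr rfl fun i _ => ?_
      rw [smul_mul_smul_comm, ← word_append, List.take_append_drop]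
    rw [hfac, colorSum_cons p j₀ L hj₀, hcut, permSum_cutSum]
    congr 1
    funext x y
    rw [ih hL']
    simp only [permSum, List.sum_map_mul_left, List.sum_map_mul_right]
    congr 1
    rw [colorBlock, symmetrize_eq_permSum]
    simp only [List.map_map, Function.comp_def, List.map_id', permSum]
    rw [smul_smul, smul_smul, List.smul_sum, List.map_map]
    congr 1
    refine List.map_congr_left fun u hu => ?_
    rw [expCoeff_perm _ (List.mem_permutations'.1 hu), expCoeff, List.prod_map_mul]
    simp only [Function.comp_apply]
    congr 1
    ring

/-- The product of the `Y_i ^ n_i` as a product over a word of content `n`. -/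
lemma exists_YMonomial_eq {r : ℕ} (p : Fin r → K) (n : ℕ →₀ ℕ) :
    ∃ s, HasContent s n ∧ YMonomial p n = (s.map (Y p)).prod := by
  refine ⟨(n.support.sort (· ≤ ·)).flatMap fun i => List.replicate (n i) i, fun i => ?_, ?_⟩
  · rw [List.count_flatMap, Function.comp_def]
    simp only [List.count_replicate]
    by_cases hi : i ∈ n.support
    · rw [List.sum_map_eq_nsmul_single i]
      · rw [List.count_eq_one_of_mem (Finset.sort_nodup _ _) (by simpa using hi)]
        simp
      · intro j hj _
        simp [hj]
    · rw [Finsupp.notMem_support_iff.1 hi]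
      refine List.sum_eq_zero fun x hx => ?_
      obtain ⟨j, hj, rfl⟩ := List.mem_map.1 hx
      have : j ≠ i := by rintro rfl; exact hi (by simpa using hj)
      simp [this]
  · rw [YMonomial]
    simp [List.flatMap_def, List.map_flatten, List.prod_flatten, Function.comp_def]

/-- The coefficients of `PS (∏ i, Y_i ^ n_i) / ∏ i, (n_i)!` are those of the product formula. -/
lemma wordCoeff_PSTerm [CharZero K] {r : ℕ} (p : Fin r → K) (c : Fin r → ℕ → K) (n : ℕ →₀ ℕ)
    (w : List ℕ) [Decidable (HasContent w n)] : wordCoeff (PSTerm p c n) w =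
      if HasContent w n then productCoeff p c (List.finRange r) w else 0 := by
  obtain ⟨s, hs, hY⟩ := exists_YMonomial_eq p n
  have h1 : substitute c (PS K (YMonomial p n)) =
      permSum (fun w => productCoeff p c (List.finRange r) w • word K w) s := by
    rw [hY, ← colorSum_orderedProd p c _ (List.nodup_finRange r)]
    refine (map_prod_Y p s ((substitute c).toLinearMap ∘ₗ PSLinear K r)).trans ?_
    simp only [LinearMap.comp_apply, PSLinear_apply, PS_word, AlgHom.toLinearMap_apply,
      substitute_timeOrderWord]
  have h2 : ∀ (l : List (List ℕ)) (G : List ℕ → K),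
      wordCoeff (l.map fun w => G w • word K w).sum w = l.count w * G w := by
    intro l G
    induction l with
    | nil => simp
    | cons x l ih =>
      rw [List.map_cons, List.sum_cons, wordCoeff_add, ih, wordCoeff_smul, wordCoeff_word,
        List.count_cons]
      by_cases h : x = w
      · simp [h]; ring
      · simp [h]
  rw [PSTerm, wordCoeff_smul, h1, permSum, h2]
  split_ifs with hw
  · rw [count_permutations' hs (hw.perm hs), ← mul_assoc, Finsupp.prod, Finsupp.prod,
      Nat.cast_prod, inv_mul_cancel₀, one_mul]
    exact Finset.prod_ne_zero_iff.2 fun i _ => by exact_mod_cast Nat.factorial_ne_zero _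
  · rw [List.count_eq_zero_of_not_mem, Nat.cast_zero, zero_mul, mul_zero]
    exact fun h => hw (hs.of_perm (List.mem_permutations'.1 h))

end TimeOrdered

/-! ### Symmetric decompositions -/

section Symmetric

variable {K : Type*} [Field K]

lemma convolution_add_left {T : Type*} (f f' g : List T → K) (w : List T) :
    convolution (fun x => f x + f' x) g w = convolution f g w + convolution f' g w := by
  simp [convolution, add_mul, Finset.sum_add_distrib]

lemma convolution_mul_left {T : Type*} (k : K) (f g : List T → K) (w : List T) :
    convolution (fun x => k * f x) g w = k * convolution f g w := by
  simp [convolution, mul_assoc, Finset.mul_sum]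

lemma convolution_assoc {T : Type*} (f g h : List T → K) :
    convolution (convolution f g) h = convolution f (convolution g h) := by
  funext w
  induction w generalizing f g with
  | nil => simp [mul_assoc]
  | cons a w ih =>
    simp only [convolution_cons, convolution_add_left, convolution_mul_left, ih, convolution_nil]
    ring

lemma convolution_unitCoeff_left {T : Type*} (f : List T → K) :
    convolution unitCoeff f = f := by
  funext w
  cases w with
  | nil => simp [unitCoeff]
  | cons a w => simp [unitCoeff, convolution]

lemma convolution_unitCoeff_right {T : Type*} (f : List T → K) :
    convolution f unitCoeff = f := by
  funext w
  induction w generalizing f with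
  | nil => simp [unitCoeff]
  | cons a w ih => simp [convolution_cons, ih, unitCoeff]

lemma productCoeff_append {ι : Type*} (p : ι → K) (c : ι → ℕ → K) (L L' : List ι) :
    productCoeff p c (L ++ L') = convolution (productCoeff p c L) (productCoeff p c L') := by
  induction L with
  | nil => simp [convolution_unitCoeff_left]
  | cons j L ih =>
    rw [List.cons_append, productCoeff_cons, ih, productCoeff_cons, convolution_assoc]

/-- The reversal of all words reverses the order of the factors, since the exponential of a linear
combination of letters is invariant. -/
lemma productCoeff_reverse {ι : Type*} (p : ι → K) (c : ι → ℕ → K) (L : List ι) (w : List ℕ) :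
    productCoeff p c L w.reverse = productCoeff p c L.reverse w := by
  induction L generalizing w with
  | nil => simp [unitCoeff]
  | cons j L ih =>
    rw [productCoeff_cons, convolution_reverse, List.reverse_cons, productCoeff_append,
      productCoeff_cons, productCoeff_nil, convolution_unitCoeff_right]
    congr 1
    · exact funext ih
    · exact funext fun x => expCoeff_perm _ x.reverse_perm

lemma productCoeff_finRange_reverse {r : ℕ} {p : Fin r → K} {c : Fin r → ℕ → K}
    (hp : ∀ j, p j.rev = p j) (hc : ∀ j i, c j.rev i = c j i) (w : List ℕ) :
    productCoeff p c (List.finRange r) w.reverse = productCoeff p c (List.finRange r) w := by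
  rw [productCoeff_reverse, List.finRange_reverse, productCoeff, productCoeff, List.map_map]
  simp only [Function.comp_def, hp, hc]

lemma even_length_iff {w : List ℕ} (hw : ∀ i ∈ w, Odd i) : Even w.length ↔ Even w.sum := by
  induction w with
  | nil => simp
  | cons a w ih =>
    have h1 := hw a List.mem_cons_self
    have h2 := ih fun i hi => hw i (List.mem_cons_of_mem _ hi)
    rw [List.length_cons, List.sum_cons, Nat.even_add_one, h2, Nat.even_add,
      ← Nat.not_odd_iff_even (n := a)]
    tauto

end Symmetric

/-! ### Induction on the weight -/

section Determining

variable {K : Type*} [Field K]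

/-- The words in the letters from `Λ` that are not powers of the first letter. -/
def mixedWords (Λ : Set ℕ) : Set (List ℕ) := {w | (∀ i ∈ w, i ∈ Λ) ∧ ∃ i ∈ w, i ≠ 1}

lemma mixedWords_perm {Λ : Set ℕ} {w w' : List ℕ} (h : w.Perm w') :
    w ∈ mixedWords Λ ↔ w' ∈ mixedWords Λ := by
  simp only [mixedWords, Set.mem_ofPred_eq, h.mem_iff]

lemma HasContent.weight_eq {w : List ℕ} {n : ℕ →₀ ℕ} (h : HasContent w n) :
    weight n = w.sum := by
  have hs : n.support = w.toFinset := by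
    ext i
    rw [Finsupp.mem_support_iff, ← h i, List.mem_toFinset, ← List.count_pos_iff,
      Nat.pos_iff_ne_zero]
  rw [weight, Finsupp.sum, hs, Finset.sum_list_count]
  exact Finset.sum_congr rfl fun i _ => by rw [h i, smul_eq_mul, mul_comm]

lemma HasContent.mem_iff {w : List ℕ} {n : ℕ →₀ ℕ} (h : HasContent w n) {i : ℕ} :
    i ∈ w ↔ n i ≠ 0 := by
  rw [← h i, ← List.count_pos_iff, Nat.pos_iff_ne_zero]

/-- The index set consists of the contents of the mixed words of bounded weight. -/
lemma HasContent.mem_indexSet_iff {w : List ℕ} {n : ℕ →₀ ℕ} (h : HasContent w n) {Λ : Set ℕ}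
    {m : ℕ} : n ∈ indexSet Λ m ↔ w ∈ mixedWords Λ ∧ w.sum ≤ m := by
  simp only [indexSet, mixedWords, Set.mem_ofPred_eq, ← h.mem_iff, h.weight_eq]
  constructor
  · rintro ⟨h1, h2, i, h3, h4⟩
    exact ⟨⟨h1, i, h4, h3⟩, h2⟩
  · rintro ⟨⟨h1, i, h4, h3⟩, h2⟩
    exact ⟨h1, h2, i, h3, h4⟩

/-- If a character vanishes at the mixed words of smaller weight, it vanishes at the proper
shuffles that consist of mixed words: one of the two words is mixed, and both have smaller
weight. -/
lemma IsShuffleCharacter.shuffleSum_eq_zero {Λ : Set ℕ} (hΛ0 : 0 ∉ Λ) {G : List ℕ → K}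
    (hG : IsShuffleCharacter G) {N : ℕ} (h : ∀ w ∈ mixedWords Λ, w.sum < N → G w = 0)
    {u v : List ℕ} (hu : u ≠ []) (hv : v ≠ []) (huv : u ++ v ∈ mixedWords Λ)
    (hN : (u ++ v).sum ≤ N) : shuffleSum G u v = 0 := by
  have hpos : ∀ w : List ℕ, w ≠ [] → (∀ i ∈ w, i ∈ Λ) → 0 < w.sum := fun w hw hwΛ =>
    (List.length_pos_iff.2 hw).trans_le
      (length_le_sum fun i hi => Nat.pos_of_ne_zero fun h0 => hΛ0 (h0 ▸ hwΛ i hi))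
  obtain ⟨hΛ, i, hi, hi1⟩ := huv
  have huΛ : ∀ i ∈ u, i ∈ Λ := fun i hi => hΛ i (List.mem_append_left _ hi)
  have hvΛ : ∀ i ∈ v, i ∈ Λ := fun i hi => hΛ i (List.mem_append_right _ hi)
  have h1 := hpos u hu huΛ
  have h2 := hpos v hv hvΛ
  rw [List.sum_append] at hN
  rw [hG.2]
  rcases List.mem_append.1 hi with hi | hi
  · rw [h u ⟨huΛ, i, hi, hi1⟩ (by omega), zero_mul]
  · rw [h v ⟨hvΛ, i, hi, hi1⟩ (by omega), mul_zero]

/-- If a character that is invariant under reversal of words vanishes at the mixed words of weight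
less than an even number `N`, it vanishes at those of weight `N`, provided all letters are odd. -/
lemma IsShuffleCharacter.eq_zero_of_even [CharZero K] {Λ : Set ℕ} (hΛ0 : 0 ∉ Λ)
    (hΛ : ∀ i ∈ Λ, Odd i) {G : List ℕ → K} (hG : IsShuffleCharacter G)
    (hrev : ∀ w, G w.reverse = G w) {w : List ℕ} (hw : w ∈ mixedWords Λ) (heven : Even w.sum)
    (h : ∀ w' ∈ mixedWords Λ, w'.sum < w.sum → G w' = 0) : G w = 0 := by
  have hw0 : w ≠ [] := by
    rintro rfl
    obtain ⟨-, i, hi, -⟩ := hw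
    simp at hi
  obtain ⟨k, hk⟩ : ∃ k, w.length = k + 1 := Nat.exists_eq_add_one.2 (List.length_pos_iff.2 hw0)
  have hlen : Even w.length := (even_length_iff fun i hi => hΛ i (hw.1 i hi)).2 heven
  -- Of the alternating sum for the antipode, only the terms of the two trivial cuts remain.
  have key := sum_neg_one_pow_shuffleSum_reverse G hw0
  rw [Finset.sum_range_succ, hk, Finset.sum_range_succ', Finset.sum_eq_zero, ← hk,
    hlen.neg_one_pow] at key
  · simp only [pow_zero, List.take_zero, List.drop_zero, List.reverse_nil, List.take_length,
      List.drop_length, shuffleSum_nil_left, shuffleSum_nil_right, hrev] at key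
    have h2 : (2 : K) * G w = 0 := by linear_combination key
    exact (mul_eq_zero.1 h2).resolve_left two_ne_zero
  · intro i hi
    have hi' := Finset.mem_range.1 hi
    have hp : ((w.take (i + 1)).reverse ++ w.drop (i + 1)).Perm w := by
      conv_rhs => rw [← List.take_append_drop (i + 1) w]
      exact (List.reverse_perm _).append_right _
    rw [hG.shuffleSum_eq_zero hΛ0 h (by simp [hw0]) (by simp; omega)
      ((mixedWords_perm hp).2 hw) hp.sum_eq.le, mul_zero]

/-- If the coefficients at the Lyndon words vanish for all contents from a subset of the index set,
and the vanishing passes on to the remaining contents from smaller weights, all coefficients at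
mixed words of bounded weight vanish. -/
lemma productCoeff_eq_zero_of_lyndon [CharZero K] {Λ : Set ℕ} (hΛ0 : 0 ∉ Λ) {m r : ℕ}
    (p : Fin r → K) (c : Fin r → ℕ → K) (S : Set (ℕ →₀ ℕ))
    (hS : ∀ n ∈ S, ∀ w : List ℕ, HasContent w n → IsLyndon w → wordCoeff (PSTerm p c n) w = 0)
    (hpass : ∀ n ∈ indexSet Λ m, n ∉ S → ∀ w, HasContent w n →
      (∀ w' ∈ mixedWords Λ, w'.sum < w.sum → productCoeff p c (List.finRange r) w' = 0) →
      productCoeff p c (List.finRange r) w = 0)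
    (w : List ℕ) (hw : w ∈ mixedWords Λ) (hwm : w.sum ≤ m) :
    productCoeff p c (List.finRange r) w = 0 := by
  classical
  induction hN : w.sum using Nat.strong_induction_on generalizing w with
  | _ N ih =>
    subst hN
    have hlow : ∀ w' ∈ mixedWords Λ, w'.sum < w.sum →
        productCoeff p c (List.finRange r) w' = 0 :=
      fun w' hw' hlt => ih _ hlt w' hw' (hlt.le.trans hwm) rfl
    have hc := hasContent_toFinsupp w
    by_cases hn : Multiset.toFinsupp (w : Multiset ℕ) ∈ S
    · refine eq_zero_of_lyndon _ w ?_ ?_ ?_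
      · rintro rfl
        obtain ⟨-, i, hi, -⟩ := hw
        simp at hi
      · intro u v hu hv huv
        exact (isShuffleCharacter_productCoeff p c _).shuffleSum_eq_zero hΛ0 hlow hu hv
          ((mixedWords_perm huv).2 hw) huv.sum_eq.le
      · intro l hl hll
        have := hS _ hn l (hc.of_perm hl) hll
        rwa [wordCoeff_PSTerm, if_pos (hc.of_perm hl)] at this
    · exact hpass _ (hc.mem_indexSet_iff.2 ⟨hw, hwm⟩) hn w hc hlow

end Determining

end HigherOrderDecomposition

end

open HigherOrderDecomposition in
theorem theorem8 {K : Type*} [Field K] [CharZero K] {A : Type*} [Ring A] [Algebra K A]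
    (Λ : Set ℕ) (hΛ0 : 0 ∉ Λ) (hΛ1 : 1 ∈ Λ)
    (m : ℕ) (R : ℕ → A) (hR0 : ∀ n, n ∉ Λ → R n = 0)
    (hR : IsFreeFamily K {i | i ∈ Λ ∧ i ≤ m} R)
    {r : ℕ} (p : Fin r → K) (hp : ∑ j, p j = 1)
    (c : Fin r → ℕ → K) (hc : ∀ j, c j 1 = 1) :
    (IsApproximant K m (R 1) (productFormula p c R) ↔
      ∀ n ∈ indexSet Λ m, ∀ w : List ℕ, HasContent w n → IsLyndon w →
        wordCoeff (PSTerm p c n) w = 0) ∧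
    ((∀ i ∈ Λ, Odd i) → (∀ j, p j.rev = p j) → (∀ j i, c j.rev i = c j i) →
      (IsApproximant K m (R 1) (productFormula p c R) ↔
        ∀ n ∈ oddIndexSet Λ m, ∀ w : List ℕ, HasContent w n → IsLyndon w →
          wordCoeff (PSTerm p c n) w = 0)) ∧
    (∀ n ∈ indexSet Λ m,
      (IsApproximant K (weight n - 1) (R 1) (productFormula p c R) →
        PSTerm p c n ∈ lieElements K n) ∧
      ∀ β : List ℕ → K, ∃! P, P ∈ lieElements K n ∧
        ∀ w : List ℕ, HasContent w n → IsLyndon w → wordCoeff P w = β w) := by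
  classical
  have happ : ∀ k ≤ m, IsApproximant K k (R 1) (productFormula p c R) ↔
      ∀ w ∈ mixedWords Λ, w.sum ≤ k → productCoeff p c (List.finRange r) w = 0 := by
    intro k hk
    rw [isApproximant_iff hΛ0 hR0 hR hp hc hk]
    exact ⟨fun h w hw hk => h w hw.1 hk hw.2, fun h w h1 h2 h3 => h w ⟨h1, h3⟩ h2⟩
  have hforward : IsApproximant K m (R 1) (productFormula p c R) →
      ∀ n ∈ indexSet Λ m, ∀ w : List ℕ, HasContent w n → IsLyndon w →
        wordCoeff (PSTerm p c n) w = 0 := by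
    intro h n hn w hw _
    obtain ⟨h1, h2⟩ := hw.mem_indexSet_iff.1 hn
    rw [wordCoeff_PSTerm, if_pos hw, (happ m le_rfl).1 h w h1 h2]
  refine ⟨⟨hforward, fun h => ?_⟩,
    fun hodd hps hcs => ⟨fun h n hn => hforward h n hn.1, fun h => ?_⟩,
    fun n hn => ?_⟩
  · exact (happ m le_rfl).2
      (productCoeff_eq_zero_of_lyndon hΛ0 p c _ h fun n hn hn' => absurd hn hn')
  · refine (happ m le_rfl).2 (productCoeff_eq_zero_of_lyndon hΛ0 p c _ h ?_)
    intro n hn hn' w hw hlow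
    have heven : Even (weight n) := by
      rw [← Nat.not_odd_iff_even]
      exact fun ho => hn' ⟨hn, ho⟩
    exact (isShuffleCharacter_productCoeff p c _).eq_zero_of_even hΛ0 hodd
      (productCoeff_finRange_reverse hps hcs) (hw.mem_indexSet_iff.1 hn).1
      (hw.weight_eq ▸ heven) hlow
  · have hn0 : n ≠ 0 := by
      rintro rfl
      obtain ⟨-, -, i, -, hi⟩ := hn
      exact hi rfl
    refine ⟨fun h => ?_, existsUnique_lieElement hn0⟩
    have hlow := (happ (weight n - 1) ((Nat.sub_le _ _).trans hn.2.1)).1 h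
    refine mem_lieElements_of_shuffleSum hn0 ?_ ?_
    · intro w hw
      by_contra hwn
      exact hw (by rw [wordCoeff_PSTerm, if_neg hwn])
    · intro u v hu hv huv
      have heq : shuffleSum (wordCoeff (PSTerm p c n)) u v =
          shuffleSum (productCoeff p c (List.finRange r)) u v := by
        rw [shuffleSum, shuffleSum]
        congr 1
        refine List.map_congr_left fun z hz => ?_
        rw [wordCoeff_PSTerm, if_pos (huv.of_perm (perm_of_mem_shuffles u v z hz))]
      rw [heq]
      refine (isShuffleCharacter_productCoeff p c _).shuffleSum_eq_zero hΛ0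
        (fun w hw hlt => hlow w hw (by omega)) hu hv (huv.mem_indexSet_iff.1 hn).1
        huv.weight_eq.ge
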